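/- Let $N\ge 1$. For $k,l\ge 0$ let $\mathcal P(k,l)$ be the set of partitions of a set of $k$ upper and $l$ lower points, and let $\mathcal{NC}(k,l)\subseteq\mathcal P(k,l)$ be the non-crossing ones (upper points ordered from left to right, followed by the lower points from right to left). For $p\in\mathcal P(k,l)$ let $T_p\in M_{N^l\times N^k}(\mathbb C)$ be the matrix whose $(\mathbf i,\mathbf j)$ entry is $1$ if writing $\mathbf j\in\{1,\dots,N\}^k$ on the upper points and $\mathbf i\in\{1,\dots,N\}^l$ on the lower points of $p$ (each from left to right) gives equal indices to any two points in the same block, and $0$ otherwise; for $p\in\mathcal P(0,k)$ write $\xi_p=T_p\in(\mathbb C^N)^{\otimes k}$. A Tannaka–Krein dual is a family of linear subspaces $\hom_{\mathcal C}(k,l)\subseteq M_{N^l\times N^k}(\mathbb C)$, $k,l\ge 0$, closed under tensor products, composition and adjoints, and containing the identity $\mathrm{id}_N\in M_{N\times N}(\mathbb C)$ and the row vector $(\delta_{j_1j_2})_{j_1,j_2}\in M_{1\times N^2}(\mathbb C)$. Write $\mathcal P$ and $\mathcal{NC}$ for the families $\operatorname{span}(T_p: p\in\mathcal P(k,l))$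 and $\operatorname{span}(T_p: p\in\mathcal{NC}(k,l))$ (the Tannaka–Krein duals of the permutation group $S_N$ and of the quantum permutation group $S_N^+$), and $\langle\mathcal{NC},\xi\rangle$ for the smallest Tannaka–Krein dual containing $\mathcal{NC}$ and $\xi$. Theorem A. The inclusion $S_N\le S_N^+$ is maximal at easiness level three. That is, for all $k\ge 0$, $p_1,p_2,p_3\in\mathcal P(0,k)$ and $\alpha_1,\alpha_2,\alpha_3\in\mathbb C$ such that $\xi=\alpha_1\xi_{p_1}+\alpha_2\xi_{p_2}+\alpha_3\xi_{p_3}$ is non-zero, $$\langle\mathcal{NC},\xi\rangle=\mathcal{NC}\quad\text{or}\quad\langle\mathcal{NC},\xi\rangle=\mathcal P .$$ -/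

import Mathlib

noncomputable section

namespace TannakaKrein

/-- Multi-indices `[N]^k`, indexing the standard basis of `(ℂ^N)^{⊗ k}`. -/
abbrev MIdx (N k : ℕ) : Type := Fin k → Fin N

/-- The matrices `M_{N^l × N^k}(ℂ)`, i.e. linear maps `(ℂ^N)^{⊗ k} → (ℂ^N)^{⊗ l}`. -/
abbrev Mat (N k l : ℕ) : Type := Matrix (MIdx N l) (MIdx N k) ℂ

/-! ### Partitions with upper and lower points -/

/-- `𝒫(k,l)`: partitions of `k` upper points (`Sum.inl`) and `l` lower points (`Sum.inr`),
given by their equivalence relation "lie in the same block". -/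
abbrev Part (k l : ℕ) : Type := Setoid (Fin k ⊕ Fin l)

/-- The position of a point in the order used to detect crossings: the upper points from left
to right, followed by the lower points from right to left. -/
def pos {k l : ℕ} : Fin k ⊕ Fin l → Fin (k + l) :=
  Sum.elim (fun i => Fin.castAdd l i) (fun j => Fin.natAdd k j.rev)

/-- Four points `a < b < c < d` form a crossing of `p` if `a ∼ c` and `b ∼ d`, but not `a ∼ b`. -/
def IsCrossing {k l : ℕ} (p : Part k l) (a b c d : Fin k ⊕ Fin l) : Prop :=
  pos a < pos b ∧ pos b < pos c ∧ pos c < pos d ∧ p.r a c ∧ p.r b d ∧ ¬ p.r a b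

/-- A partition is non-crossing if it has no crossings. -/
def IsNonCrossing {k l : ℕ} (p : Part k l) : Prop :=
  ∀ a b c d : Fin k ⊕ Fin l, ¬ IsCrossing p a b c d

open Classical in
/-- The matrix `T_p` of a partition `p ∈ 𝒫(k,l)` at parameter `N`. Its `(i, j)` entry is `1` if
writing `j` on the upper points and `i` on the lower points gives equal indices to any two points
in the same block, and `0` otherwise. -/
def T (N : ℕ) {k l : ℕ} (p : Part k l) : Mat N k l :=
  fun i j => if ∀ x y : Fin k ⊕ Fin l, p.r x y → Sum.elim j i x = Sum.elim j i y then 1 else 0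

/-- The vector `ξ_p = T_p ∈ (ℂ^N)^{⊗ k}` of a partition `p ∈ 𝒫(0,k)`. -/
abbrev xi (N : ℕ) {k : ℕ} (p : Part 0 k) : Mat N 0 k := T N p

/-! ### Tannaka–Krein duals -/

/-- The Kronecker tensor product of linear maps, `[S ⊗ T]_{ii', jj'} = S_{i,j} T_{i',j'}`. -/
def tensor {N k l k' l' : ℕ} (A : Mat N k l) (B : Mat N k' l') : Mat N (k + k') (l + l') :=
  fun i j => A (fun a => i (Fin.castAdd l' a)) (fun b => j (Fin.castAdd k' b)) *
    B (fun a => i (Fin.natAdd l a)) (fun b => j (Fin.natAdd k b))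

/-- The row vector in `hom(2,0)` with entries `δ_{j₁ j₂}`. -/
def cup (N : ℕ) : Mat N 2 0 := fun _ j => if j 0 = j 1 then 1 else 0

/-- A collection of vector spaces `hom(k,l) ⊆ M_{N^l × N^k}(ℂ)`, `k, l ≥ 0`, ordered by inclusion. -/
abbrev HomFamily (N : ℕ) : Type := (k l : ℕ) → Submodule ℂ (Mat N k l)

/-- A collection of vector spaces is a (orthogonal) Tannaka–Krein dual if it is closed under tensor
products, compositions and adjoints, and contains `id_N` and the row vector `(δ_{j₁ j₂})`. -/
structure IsTannakaKreinDual {N : ℕ} (C : HomFamily N) : Prop where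
  tensor_mem : ∀ {k l k' l' : ℕ} {A : Mat N k l} {B : Mat N k' l'},
    A ∈ C k l → B ∈ C k' l' → tensor A B ∈ C (k + k') (l + l')
  comp_mem : ∀ {k l r : ℕ} {A : Mat N l r} {B : Mat N k l},
    A ∈ C l r → B ∈ C k l → A * B ∈ C k r
  adjoint_mem : ∀ {k l : ℕ} {A : Mat N k l}, A ∈ C k l → A.conjTranspose ∈ C l k
  id_mem : (1 : Mat N 1 1) ∈ C 1 1
  cup_mem : cup N ∈ C 2 0

/-- `hom_𝒫(k,l) = span(T_p : p ∈ 𝒫(k,l))`. -/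
def catP (N : ℕ) : HomFamily N := fun k l =>
  Submodule.span ℂ {A | ∃ p : Part k l, A = T N p}

/-- `hom_𝒩𝒞(k,l) = span(T_p : p ∈ 𝒩𝒞(k,l))`. -/
def catNC (N : ℕ) : HomFamily N := fun k l =>
  Submodule.span ℂ {A | ∃ p : Part k l, IsNonCrossing p ∧ A = T N p}

/-- `⟨C, A⟩`: the smallest Tannaka–Krein dual that contains `C` and the matrix `A`. -/
def generated {N k l : ℕ} (C : HomFamily N) (A : Mat N k l) : HomFamily N :=
  sInf {D : HomFamily N | IsTannakaKreinDual D ∧ C ≤ D ∧ A ∈ D k l}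

lemma mem_sInf {N : ℕ} {𝒟 : Set (HomFamily N)} {k l : ℕ} {A : Mat N k l} :
    A ∈ (sInf 𝒟 : HomFamily N) k l ↔ ∀ D ∈ 𝒟, A ∈ D k l := by
  simp only [sInf_apply, iInf_apply, Submodule.mem_iInf, Subtype.forall]

/-- `⟨C, A⟩` is indeed the least Tannaka–Krein dual containing `C` and `A`. -/
theorem generated_isLeast {N k l : ℕ} (C : HomFamily N) (A : Mat N k l) :
    IsLeast {D : HomFamily N | IsTannakaKreinDual D ∧ C ≤ D ∧ A ∈ D k l} (generated C A) := by
  refine ⟨⟨⟨?_, ?_, ?_, ?_, ?_⟩, ?_, ?_⟩, fun D hD => sInf_le hD⟩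
  · exact fun ha hb => mem_sInf.2 fun D hD =>
      hD.1.tensor_mem (mem_sInf.1 ha D hD) (mem_sInf.1 hb D hD)
  · exact fun ha hb => mem_sInf.2 fun D hD =>
      hD.1.comp_mem (mem_sInf.1 ha D hD) (mem_sInf.1 hb D hD)
  · exact fun ha => mem_sInf.2 fun D hD => hD.1.adjoint_mem (mem_sInf.1 ha D hD)
  · exact mem_sInf.2 fun D hD => hD.1.id_mem
  · exact mem_sInf.2 fun D hD => hD.1.cup_mem
  · exact le_sInf fun D hD => hD.2.1
  · exact mem_sInf.2 fun D hD => hD.2.2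

/-- The inclusion `S_N ≤ S_N^+` (whose Tannaka–Krein duals are `𝒫` and `𝒩𝒞`) is maximal at
easiness level `m`: for every `k` and every non-zero linear combination `ξ` of `m` partition
vectors in `hom_𝒫(0,k)`, the Tannaka–Krein dual `⟨𝒩𝒞, ξ⟩` is `𝒩𝒞` or `𝒫`. -/
def MaximalAtEasinessLevel (N m : ℕ) : Prop :=
  ∀ (k : ℕ) (p : Fin m → Part 0 k) (α : Fin m → ℂ),
    ∑ i, α i • xi N (p i) ≠ 0 →
      generated (catNC N) (∑ i, α i • xi N (p i)) = catNC N ∨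
      generated (catNC N) (∑ i, α i • xi N (p i)) = catP N

end TannakaKrein

end

/-! Let `D` be a Tannaka–Krein dual containing `catNC N`. Multiplying a vector of `D` by the matrix
of a monotone map, or by its adjoint, stays in `D`; this allows identifying two neighbouring tensor
factors (`merge_mem`) and summing out one factor (`delete_mem`). On a partition vector these
operations merge two neighbouring points or remove a point, up to a non-zero scalar
(`xi_mergePoints`, `exists_xi_deletePoint`).

In the given combination the non-crossing terms lie in `catNC N` and can be dropped. If nothing is
left, the generated dual is `catNC N`. Otherwise at most three crossing partitions remain. The
combinatorial core, `exists_separating_reduce`, says that on at least five points some elementary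
reduction keeps one of them crossing and separates its image from the images of the others, so that
its coefficient survives. Iterating down to four points, where there is only one crossing partition,
puts `crossVec N` into `D` (`crossVec_mem`). The induction handles formal combinations, so linear
dependence of the vectors for small `N` does no harm.

Bending two legs of `crossVec N` gives the flip, hence all permutations of tensor factors, hence the
matrices of all maps of indices; every `T N p` is a product of one of these with an adjoint of
another (`catP_le_of_crossVec_mem`).

Why three partitions can be separated: if no reduction works, each crossing image is shared by two
partitions, and two different crossing images would require four. So under each reduction all
crossing images agree, and two distinct partitions with a common crossing cannot agree in this way
on six or more points (`le_of_forall_reduce_eq`). Five points are a finite check. -/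

namespace TannakaKrein

open Finset

/-! ### Setoids and the order of their points -/

/-- `p` has no crossing among the points of `Y`, listed in the order given by `o`. -/
def NonCrossingOn {X : Type*} (o : X → ℕ) (Y : Set X) (p : Setoid X) : Prop :=
  ∀ a ∈ Y, ∀ b ∈ Y, ∀ c ∈ Y, ∀ d ∈ Y,
    o a < o b → o b < o c → o c < o d → p a c → p b d → p a b

/-- The setoid obtained from `p` by merging the blocks of `u` and `v`. -/
def joinPair {X : Type*} (p : Setoid X) (u v : X) : Setoid X where
  r x y := p x y ∨ ((p x u ∨ p x v) ∧ (p y u ∨ p y v))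
  iseqv :=
    { refl := fun x => Or.inl (p.refl x)
      symm := by
        rintro x y (h | ⟨h, h'⟩)
        · exact Or.inl (p.symm h)
        · exact Or.inr ⟨h', h⟩
      trans := by
        rintro x y z (h | ⟨h, h'⟩) (g | ⟨g, g'⟩)
        · exact Or.inl (p.trans h g)
        · exact Or.inr ⟨g.imp (p.trans h) (p.trans h), g'⟩
        · exact Or.inr ⟨h, h'.imp (p.trans (p.symm g)) (p.trans (p.symm g))⟩
        · exact Or.inr ⟨h, g'⟩ }

lemma joinPair_apply {X : Type*} (p : Setoid X) (u v x y : X) :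
    joinPair p u v x y ↔ p x y ∨ ((p x u ∨ p x v) ∧ (p y u ∨ p y v)) := Iff.rfl

/-- The colouring `x` is constant on the blocks of `p`. -/
def Compat {X C : Type*} (p : Setoid X) (x : X → C) : Prop := ∀ a b, p a b → x a = x b

lemma compat_joinPair {X C : Type*} (p : Setoid X) (u v : X) (x : X → C) :
    Compat (joinPair p u v) x ↔ Compat p x ∧ x u = x v := by
  constructor
  · intro h
    exact ⟨fun a b hab => h a b (Or.inl hab),
      h u v (Or.inr ⟨Or.inl (p.refl u), Or.inr (p.refl v)⟩)⟩
  · rintro ⟨h, huv⟩ a b (hab | ⟨ha, hb⟩)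
    · exact h a b hab
    · have h1 : x a = x u := ha.elim (h a u) (fun g => (h a v g).trans huv.symm)
      have h2 : x b = x u := hb.elim (h b u) (fun g => (h b v g).trans huv.symm)
      rw [h1, h2]

lemma NonCrossingOn.mono {X : Type*} {o : X → ℕ} {Y Z : Set X} {p : Setoid X}
    (h : NonCrossingOn o Y p) (hZ : Z ⊆ Y) : NonCrossingOn o Z p :=
  fun a ha b hb c hc d hd => h a (hZ ha) b (hZ hb) c (hZ hc) d (hZ hd)

/-- Merging the blocks of two neighbouring points creates no crossing. -/
lemma NonCrossingOn.joinPair {X : Type*} {o : X → ℕ} {Y : Set X} {p : Setoid X}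
    (h : NonCrossingOn o Y p) {u v : X} (hu : u ∈ Y) (hv : v ∈ Y)
    (hadj : ∀ w ∈ Y, o w ≤ o u ∨ o v ≤ o w) (huv : o u ≤ o v) (ho : Set.InjOn o Y) :
    NonCrossingOn o Y (joinPair p u v) := by
  -- If `z` lies strictly between two points of a block not containing it, the whole block of `z` is
  -- enclosed between them.
  have key : ∀ x ∈ Y, ∀ y ∈ Y, ∀ z ∈ Y, p x y → o x < o z → o z < o y → ¬ p x z →
      ∀ t ∈ Y, p z t → o x < o t ∧ o t < o y := by
    intro x hx y hy z hz hxy hxz hzy hnot t ht hzt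
    have hxt : o x ≠ o t := fun e => hnot (by
      have := ho hx ht e; subst this; exact p.symm hzt)
    have hyt : o t ≠ o y := fun e => hnot (by
      have := ho ht hy e; subst this; exact p.trans hxy (p.symm hzt))
    refine ⟨?_, ?_⟩
    · by_contra hc
      exact hnot (p.trans (p.symm (h t ht x hx z hz y hy (by omega) hxz hzy (p.symm hzt) hxy))
        (p.symm hzt))
    · by_contra hc
      exact hnot (h x hx z hz y hy t ht hxz hzy (by omega) hxy hzt)
  -- a block disjoint from those of `u` and `v` cannot separate two points of their union
  have sep : ∀ x ∈ Y, ∀ y ∈ Y, p x y → ¬ p x u → ¬ p x v → ∀ z ∈ Y, (p z u ∨ p z v) →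
      o x < o z → o z < o y → ∀ t ∈ Y, (p t u ∨ p t v) → o x < o t ∧ o t < o y := by
    intro x hx y hy hxy hxu hxv z hz hzU hxz hzy t ht htU
    have hyu : ¬ p y u := fun g => hxu (p.trans hxy g)
    have hyv : ¬ p y v := fun g => hxv (p.trans hxy g)
    have hnz : ¬ p x z := fun g => hzU.elim (fun g' => hxu (p.trans g g')) fun g' => hxv (p.trans g g')
    have nu : o x ≠ o u := fun e => hxu (by rw [ho hx hu e])
    have nv : o x ≠ o v := fun e => hxv (by rw [ho hx hv e])
    have mu : o y ≠ o u := fun e => hyu (by rw [ho hy hu e])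
    have mv : o y ≠ o v := fun e => hyv (by rw [ho hy hv e])
    have hax := hadj x hx
    have hay := hadj y hy
    -- Neither `x` nor `y` can separate the neighbours `u` and `v`: once one of them is enclosed, so
    -- is the other.
    have huI : (o x < o u ∧ o u < o y) ∧ (o x < o v ∧ o v < o y) := by
      rcases hzU with g | g
      · have := key x hx y hy z hz hxy hxz hzy hnz u hu g
        omega
      · have := key x hx y hy z hz hxy hxz hzy hnz v hv g
        omega
    rcases htU with g | g
    · exact key x hx y hy u hu hxy huI.1.1 huI.1.2 hxu t ht (p.symm g)
    · exact key x hx y hy v hv hxy huI.2.1 huI.2.2 hxv t ht (p.symm g)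
  intro a ha b hb c hc d hd hab hbc hcd hac hbd
  rcases hac with hac | ⟨haU, hcU⟩
  · rcases hbd with hbd | ⟨hbU, hdU⟩
    · exact Or.inl (h a ha b hb c hc d hd hab hbc hcd hac hbd)
    · by_cases haU : p a u ∨ p a v
      · exact Or.inr ⟨haU, hbU⟩
      · push Not at haU
        have := sep a ha c hc hac haU.1 haU.2 b hb hbU hab hbc d hd hdU
        omega
  · rcases hbd with hbd | ⟨hbU, hdU⟩
    · by_cases hbU : p b u ∨ p b v
      · exact Or.inr ⟨haU, hbU⟩
      · push Not at hbU
        have := sep b hb d hd hbd hbU.1 hbU.2 c hc hcU hbc hcd a ha haU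
        omega
    · exact Or.inr ⟨haU, hbU⟩

/-- The disjoint union of two setoids. -/
def sumSetoid {X Y : Type*} (p : Setoid X) (q : Setoid Y) : Setoid (X ⊕ Y) :=
  Setoid.ker (Sum.map (Quotient.mk p) (Quotient.mk q))

lemma sumSetoid_inl {X Y : Type*} (p : Setoid X) (q : Setoid Y) (x x' : X) :
    sumSetoid p q (Sum.inl x) (Sum.inl x') ↔ p x x' := by
  change Sum.inl (Quotient.mk p x) = Sum.inl (Quotient.mk p x') ↔ _
  rw [Sum.inl.injEq]
  exact Quotient.eq

lemma sumSetoid_inr {X Y : Type*} (p : Setoid X) (q : Setoid Y) (x x' : Y) :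
    sumSetoid p q (Sum.inr x) (Sum.inr x') ↔ q x x' := by
  change Sum.inr (Quotient.mk q x) = Sum.inr (Quotient.mk q x') ↔ _
  rw [Sum.inr.injEq]
  exact Quotient.eq

lemma not_sumSetoid_inl_inr {X Y : Type*} (p : Setoid X) (q : Setoid Y) (x : X) (y : Y) :
    ¬ sumSetoid p q (Sum.inl x) (Sum.inr y) :=
  fun h => Sum.inl_ne_inr (show Sum.inl (Quotient.mk p x) = Sum.inr (Quotient.mk q y) from h)

lemma not_sumSetoid_inr_inl {X Y : Type*} (p : Setoid X) (q : Setoid Y) (x : X) (y : Y) :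
    ¬ sumSetoid p q (Sum.inr y) (Sum.inl x) :=
  fun h => Sum.inr_ne_inl (show Sum.inr (Quotient.mk q y) = Sum.inl (Quotient.mk p x) from h)

lemma compat_sumSetoid {X Y C : Type*} (p : Setoid X) (q : Setoid Y) (x : X ⊕ Y → C) :
    Compat (sumSetoid p q) x ↔
      Compat p (fun a => x (Sum.inl a)) ∧ Compat q (fun b => x (Sum.inr b)) := by
  constructor
  · intro h
    exact ⟨fun a b hab => h _ _ ((sumSetoid_inl p q a b).2 hab),
      fun a b hab => h _ _ ((sumSetoid_inr p q a b).2 hab)⟩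
  · rintro ⟨h, h'⟩ (a | a) (b | b) hab
    · exact h a b ((sumSetoid_inl p q a b).1 hab)
    · exact absurd hab (not_sumSetoid_inl_inr p q a b)
    · exact absurd hab (not_sumSetoid_inr_inl p q b a)
    · exact h' a b ((sumSetoid_inr p q a b).1 hab)

/-- A disjoint union is non-crossing if no point of the first part lies between two points of the
second part. -/
lemma nonCrossingOn_sumSetoid {X Y : Type*} {p : Setoid X} {q : Setoid Y} {o : X ⊕ Y → ℕ}
    (hp : NonCrossingOn (fun a => o (Sum.inl a)) Set.univ p)
    (hq : NonCrossingOn (fun a => o (Sum.inr a)) Set.univ q)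
    (hconv : ∀ y x y', ¬ (o (Sum.inr y) < o (Sum.inl x) ∧ o (Sum.inl x) < o (Sum.inr y'))) :
    NonCrossingOn o Set.univ (sumSetoid p q) := by
  rintro (a | a) - (b | b) - (c | c) - (d | d) - hab hbc hcd hac hbd <;>
    first
      | exact absurd hac (not_sumSetoid_inl_inr p q _ _)
      | exact absurd hac (not_sumSetoid_inr_inl p q _ _)
      | exact absurd hbd (not_sumSetoid_inl_inr p q _ _)
      | exact absurd hbd (not_sumSetoid_inr_inl p q _ _)
      | exact absurd ⟨hab, hbc⟩ (hconv _ _ _)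
      | exact absurd ⟨hbc, hcd⟩ (hconv _ _ _)
      | skip
  · rw [sumSetoid_inl] at hac hbd ⊢
    exact hp a trivial b trivial c trivial d trivial hab hbc hcd hac hbd
  · rw [sumSetoid_inr] at hac hbd ⊢
    exact hq a trivial b trivial c trivial d trivial hab hbc hcd hac hbd

/-! ### Counting the extensions of a colouring -/

open Classical in
/-- The number of ways to extend a colouring of `A` to a colouring of `A ⊕ B` constant on the blocks
of `p` does not depend on the colouring of `A`, as long as that is constant on the blocks. -/
lemma exists_sum_compat (N : ℕ) {A B : Type*} [Fintype B] [DecidableEq B] (p : Setoid (A ⊕ B)) :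
    ∃ c : ℕ, ∀ x : A → Fin N,
      (∑ m : B → Fin N, if Compat p (Sum.elim x m) then (1 : ℂ) else 0) =
        c * if Compat (p.comap Sum.inl) x then (1 : ℂ) else 0 := by
  rcases Nat.eq_zero_or_pos N with rfl | hN
  · by_cases hA : IsEmpty A
    · refine ⟨∑ m : B → Fin 0, if Compat p (Sum.elim (fun a => isEmptyElim a) m) then 1 else 0,
        fun x => ?_⟩
      have h1 : x = fun a => isEmptyElim a := by
        funext a; exact isEmptyElim a
      have h2 : Compat (p.comap Sum.inl) x := fun a => isEmptyElim a
      rw [if_pos h2, ← h1]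
      push_cast
      simp
    · rw [not_isEmpty_iff] at hA
      obtain ⟨a⟩ := hA
      exact ⟨0, fun x => (x a).elim0⟩
  let z : Fin N := ⟨0, hN⟩
  let touch : B → Prop := fun b => ∃ a, p (Sum.inl a) (Sum.inr b)
  -- The constant counts colourings of `B` in which every block touching `A` has the fixed colour
  -- `z`. Exchanging `z` for the colour forced by `x` on these blocks gives the bijection with the
  -- extensions of `x`.
  refine ⟨#{m : B → Fin N | Compat (p.comap Sum.inr) m ∧ ∀ b, touch b → m b = z}, fun x => ?_⟩
  by_cases hx : Compat (p.comap Sum.inl) x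
  · rw [if_pos hx, mul_one, Finset.sum_boole, Nat.cast_inj]
    let g : B → Fin N := fun b => if h : touch b then x h.choose else z
    have hg : ∀ a b, p (Sum.inl a) (Sum.inr b) → g b = x a := by
      intro a b hab
      have h : touch b := ⟨a, hab⟩
      simp only [g, dif_pos h]
      exact hx _ _ (p.trans h.choose_spec (p.symm hab))
    have htouch : ∀ b b', p (Sum.inr b) (Sum.inr b') → touch b → touch b' :=
      fun b b' h ⟨a, ha⟩ => ⟨a, p.trans ha h⟩
    refine Finset.card_bij' (fun m _ b => if touch b then z else m b)
      (fun m _ b => if touch b then g b else m b) ?_ ?_ ?_ ?_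
    · intro m hm
      simp only [mem_filter, mem_univ, true_and] at hm ⊢
      refine ⟨fun b b' hbb => ?_, fun b hb => if_pos hb⟩
      by_cases h : touch b
      · simp [h, htouch b b' hbb h]
      · have h' : ¬ touch b' := fun h' => h (htouch b' b (p.symm hbb) h')
        simpa [h, h'] using hm _ _ hbb
    · intro m hm
      simp only [mem_filter, mem_univ, true_and] at hm ⊢
      rintro (a | b) (a' | b') hab
      · exact hx a a' hab
      · have h : touch b' := ⟨a, hab⟩
        simp [h, hg a b' hab]
      · have h : touch b := ⟨a', p.symm hab⟩
        simp [h, hg a' b (p.symm hab)]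
      · by_cases h : touch b
        · have h' := htouch b b' hab h
          obtain ⟨a, ha⟩ := h
          have e1 := hg a b ha
          have e2 := hg a b' (p.trans ha hab)
          simp [h', show touch b from ⟨a, ha⟩, e1, e2]
        · have h' : ¬ touch b' := fun h' => h (htouch b' b (p.symm hab) h')
          simpa [h, h'] using hm.1 _ _ hab
    · intro m hm
      simp only [mem_filter, mem_univ, true_and] at hm
      funext b
      by_cases h : touch b
      · obtain ⟨a, ha⟩ := h
        simp only [show touch b from ⟨a, ha⟩, if_true]
        rw [hg a b ha]
        exact hm _ _ ha
      · simp [h]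
    · intro m hm
      simp only [mem_filter, mem_univ, true_and] at hm
      funext b
      by_cases h : touch b
      · simp [h, hm.2 b h]
      · simp [h]
  · rw [if_neg hx, mul_zero]
    refine Finset.sum_eq_zero fun m _ => if_neg fun h => hx fun a b hab => ?_
    simpa using h _ _ hab

end TannakaKrein

noncomputable section

namespace TannakaKrein

open Finset

/-! ### Pullbacks of partitions and the entries of `T` -/

lemma NonCrossingOn.comap {X Z : Type*} {o : X → ℕ} {o' : Z → ℕ} {Y : Set X} {Y' : Set Z}
    {p : Setoid X} (h : NonCrossingOn o Y p) (f : Z → X) (hY : ∀ z ∈ Y', f z ∈ Y)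
    (hf : ∀ a b, o' a < o' b → o (f a) < o (f b)) : NonCrossingOn o' Y' (p.comap f) :=
  fun a ha b hb c hc d hd hab hbc hcd hac hbd =>
    h (f a) (hY a ha) (f b) (hY b hb) (f c) (hY c hc) (f d) (hY d hd) (hf _ _ hab) (hf _ _ hbc)
      (hf _ _ hcd) hac hbd

lemma compat_comap {X Z C : Type*} (p : Setoid X) {e : Z → X} (he : Function.Surjective e)
    (x : X → C) : Compat (p.comap e) (x ∘ e) ↔ Compat p x := by
  constructor
  · intro h a b hab
    obtain ⟨a, rfl⟩ := he a
    obtain ⟨b, rfl⟩ := he b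
    exact h a b hab
  · exact fun h a b hab => h _ _ hab

lemma pos_inl {k l : ℕ} (a : Fin k) : (pos (Sum.inl a : Fin k ⊕ Fin l) : ℕ) = a := rfl

lemma pos_inr {k l : ℕ} (b : Fin l) : (pos (Sum.inr b : Fin k ⊕ Fin l) : ℕ) = k + (l - (b + 1)) := by
  simp [pos, Fin.val_rev]

lemma isNonCrossing_iff {k l : ℕ} (p : Part k l) :
    IsNonCrossing p ↔ NonCrossingOn (fun x => (pos x : ℕ)) Set.univ p := by
  constructor
  · intro h a _ b _ c _ d _ hab hbc hcd hac hbd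
    by_contra hn
    exact h a b c d ⟨hab, hbc, hcd, hac, hbd, hn⟩
  · rintro h a b c d ⟨hab, hbc, hcd, hac, hbd, hn⟩
    exact hn (h a trivial b trivial c trivial d trivial hab hbc hcd hac hbd)

open Classical in
lemma T_apply (N : ℕ) {k l : ℕ} (p : Part k l) (i : MIdx N l) (j : MIdx N k) :
    T N p i j = if Compat p (Sum.elim j i) then 1 else 0 := by
  unfold T Compat
  congr

/-! ### Composition -/

/-- Two partitions drawn on top of each other, with the first `t` pairs of middle points merged. -/
def stack {k l r : ℕ} (p : Part l r) (q : Part k l) :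
    ℕ → Setoid ((Fin k ⊕ Fin l) ⊕ (Fin l ⊕ Fin r))
  | 0 => sumSetoid q p
  | t + 1 => if h : t < l then
      joinPair (stack p q t) (Sum.inl (Sum.inr ⟨t, h⟩)) (Sum.inr (Sum.inl ⟨t, h⟩))
    else stack p q t

/-- The order of the points of two stacked partitions. -/
def stackOrder (k l r : ℕ) : (Fin k ⊕ Fin l) ⊕ (Fin l ⊕ Fin r) → ℕ :=
  Sum.elim (fun x => pos x) (fun x => k + l + pos x)

lemma pos_injective {k l : ℕ} : Function.Injective (pos : Fin k ⊕ Fin l → Fin (k + l)) := by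
  rintro (a | a) (b | b) h <;> have h' := congrArg Fin.val h <;>
    simp only [pos_inl, pos_inr] at h'
  · rw [Fin.ext h']
  · omega
  · omega
  · rw [show a = b from Fin.ext (by omega)]

lemma stackOrder_injective (k l r : ℕ) : Function.Injective (stackOrder k l r) := by
  rintro (a | a) (b | b) h <;> simp only [stackOrder, Sum.elim_inl, Sum.elim_inr] at h
  · rw [pos_injective (Fin.ext h : pos a = pos b)]
  · have := (pos a).2; omega
  · have := (pos b).2; omega
  · rw [pos_injective (Fin.ext (by omega) : pos a = pos b)]

/-- In `stackOrder` the lower points of `q`, read from right to left, are followed by the upper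
points of `p`, read from left to right, so the middle pair with index 0 is adjacent. Once `t` pairs
have been merged and are left out of the row, the next pair is adjacent, and
`NonCrossingOn.joinPair` applies. -/
lemma nonCrossingOn_stack {k l r : ℕ} {p : Part l r} {q : Part k l} (hp : IsNonCrossing p)
    (hq : IsNonCrossing q) (t : ℕ) : NonCrossingOn (stackOrder k l r)
      {z | stackOrder k l r z + t < k + l ∨ k + l + t ≤ stackOrder k l r z} (stack p q t) := by
  rw [isNonCrossing_iff] at hp hq
  induction t with
  | zero =>
    refine (nonCrossingOn_sumSetoid (o := stackOrder k l r) hq ?_ ?_).mono (Set.subset_univ _)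
    · exact fun a ha b hb c hc d hd h1 h2 h3 => hp a ha b hb c hc d hd
        (by simpa [stackOrder] using h1) (by simpa [stackOrder] using h2)
        (by simpa [stackOrder] using h3)
    · rintro y x y' ⟨h, -⟩
      simp only [stackOrder, Sum.elim_inl, Sum.elim_inr] at h
      have := (pos x).2
      omega
  | succ t ih =>
    rw [stack]
    split_ifs with h
    · have hu : stackOrder k l r (Sum.inl (Sum.inr ⟨t, h⟩)) = k + (l - (t + 1)) := by
        simp only [stackOrder, Sum.elim_inl, pos_inr]
      have hv : stackOrder k l r (Sum.inr (Sum.inl ⟨t, h⟩)) = k + l + t := by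
        simp only [stackOrder, Sum.elim_inr, pos_inl]
      refine (ih.joinPair ?_ ?_ ?_ ?_ (stackOrder_injective k l r).injOn).mono ?_
      · simp only [Set.mem_ofPred_eq, hu]; omega
      · simp only [Set.mem_ofPred_eq, hv]; omega
      · intro w hw
        simp only [Set.mem_ofPred_eq] at hw
        rw [hu, hv]; omega
      · omega
      · intro w hw
        simp only [Set.mem_ofPred_eq] at hw ⊢
        omega
    · refine ih.mono fun w hw => ?_
      simp only [Set.mem_ofPred_eq] at hw ⊢
      omega

lemma compat_stack {k l r : ℕ} (p : Part l r) (q : Part k l) {C : Type*}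
    (x : (Fin k ⊕ Fin l) ⊕ (Fin l ⊕ Fin r) → C) (t : ℕ) :
    Compat (stack p q t) x ↔ Compat (sumSetoid q p) x ∧
      ∀ b : Fin l, (b : ℕ) < t → x (Sum.inl (Sum.inr b)) = x (Sum.inr (Sum.inl b)) := by
  induction t with
  | zero => simp [stack]
  | succ t ih =>
    rw [stack]
    split_ifs with h
    · rw [compat_joinPair, ih, and_assoc]
      refine and_congr_right fun _ => ⟨?_, fun H => ⟨fun b hb => H b (by omega), H ⟨t, h⟩ (by simp)⟩⟩
      rintro ⟨h1, h2⟩ b hb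
      rcases Nat.lt_succ_iff_lt_or_eq.1 hb with hb | hb
      · exact h1 b hb
      · have : b = ⟨t, h⟩ := Fin.ext hb
        rw [this]; exact h2
    · rw [ih]
      refine and_congr_right fun _ => ⟨fun H b _ => H b (by omega), fun H b hb => H b (by omega)⟩

/-- The inclusion of the outer points into two stacked partitions. -/
def outer (k l r : ℕ) : Fin k ⊕ Fin r → (Fin k ⊕ Fin l) ⊕ (Fin l ⊕ Fin r) :=
  Sum.map Sum.inl Sum.inr

/-- The composition of two partitions. -/
abbrev compPart {k l r : ℕ} (p : Part l r) (q : Part k l) : Part k r :=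
  (stack p q l).comap (outer k l r)

lemma isNonCrossing_compPart {k l r : ℕ} {p : Part l r} {q : Part k l} (hp : IsNonCrossing p)
    (hq : IsNonCrossing q) : IsNonCrossing (compPart p q) := by
  rw [isNonCrossing_iff]
  refine (nonCrossingOn_stack hp hq l).comap (outer k l r) ?_ ?_
  · rintro (a | b) -
    · left
      simp only [outer, Sum.map_inl, stackOrder, Sum.elim_inl, pos_inl]
      omega
    · right
      simp only [outer, Sum.map_inr, stackOrder, Sum.elim_inr, pos_inr]
      omega
  · rintro (a | a) (b | b) h <;>
      simp only [outer, Sum.map_inr, Sum.map_inl, stackOrder, Sum.elim_inr, Sum.elim_inl,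
        pos_inr, pos_inl] at h ⊢ <;> omega

/-- Doubling the middle row turns the matrix product into a count of the colourings of the inner
points of the stack that extend the colouring of the outer points; `exists_sum_compat` shows that
this count is a constant on compatible outer colourings. -/
lemma T_mul_T (N : ℕ) {k l r : ℕ} (p : Part l r) (q : Part k l) :
    ∃ c : ℕ, T N p * T N q = (c : ℂ) • T N (compPart p q) := by
  classical
  let e : (Fin k ⊕ Fin r) ⊕ (Fin l ⊕ Fin l) → (Fin k ⊕ Fin l) ⊕ (Fin l ⊕ Fin r) :=
    Sum.elim (outer k l r) (Sum.map Sum.inr Sum.inl)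
  have he : Function.Surjective e := by
    rintro ((a | a) | (a | a))
    · exact ⟨Sum.inl (Sum.inl a), rfl⟩
    · exact ⟨Sum.inr (Sum.inl a), rfl⟩
    · exact ⟨Sum.inr (Sum.inr a), rfl⟩
    · exact ⟨Sum.inl (Sum.inr a), rfl⟩
  obtain ⟨c, hc⟩ := exists_sum_compat N ((stack p q l).comap e)
  refine ⟨c, ?_⟩
  ext i j
  have h := hc (Sum.elim j i)
  rw [Matrix.smul_apply, T_apply, smul_eq_mul]
  have h1 : (((stack p q l).comap e).comap Sum.inl) = compPart p q := rfl
  rw [h1] at h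
  rw [← h, Matrix.mul_apply]
  refine Eq.trans ?_ ((Equiv.sumArrowEquivProdArrow (Fin l) (Fin l) (Fin N)).symm.sum_comp _)
  rw [Fintype.sum_prod_type]
  refine Finset.sum_congr rfl fun m _ => ?_
  have h2 : ∀ m' : Fin l → Fin N,
      Compat ((stack p q l).comap e) (Sum.elim (Sum.elim j i)
        ((Equiv.sumArrowEquivProdArrow (Fin l) (Fin l) (Fin N)).symm (m, m'))) ↔
      m = m' ∧ Compat p (Sum.elim m i) ∧ Compat q (Sum.elim j m) := by
    intro m'
    have h3 : Sum.elim (Sum.elim j i)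
        ((Equiv.sumArrowEquivProdArrow (Fin l) (Fin l) (Fin N)).symm (m, m')) =
        Sum.elim (Sum.elim j m) (Sum.elim m' i) ∘ e := by
      funext x
      rcases x with (a | a) | (a | a) <;> rfl
    rw [h3, compat_comap _ he, compat_stack, compat_sumSetoid]
    constructor
    · rintro ⟨⟨h4, h5⟩, h6⟩
      have h7 : m = m' := funext fun b => h6 b b.2
      subst h7
      exact ⟨rfl, h5, h4⟩
    · rintro ⟨rfl, h5, h4⟩
      exact ⟨⟨h4, h5⟩, fun b _ => rfl⟩
  simp only [h2, ite_and, Finset.sum_ite_eq, Finset.mem_univ, if_true, T_apply]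
  split_ifs <;> simp

/-! ### Tensor products and adjoints -/

/-- The position of a point in one of two horizontally juxtaposed partitions. -/
def tensorSplit (k l k' l' : ℕ) : Fin (k + k') ⊕ Fin (l + l') → (Fin k ⊕ Fin l) ⊕ (Fin k' ⊕ Fin l') :=
  Sum.elim (Fin.addCases (fun a => Sum.inl (Sum.inl a)) (fun a => Sum.inr (Sum.inl a)))
    (Fin.addCases (fun a => Sum.inl (Sum.inr a)) (fun a => Sum.inr (Sum.inr a)))

/-- Horizontal juxtaposition of partitions. -/
abbrev tensorPart {k l k' l' : ℕ} (p : Part k l) (q : Part k' l') : Part (k + k') (l + l') :=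
  (sumSetoid p q).comap (tensorSplit k l k' l')

lemma tensor_T (N : ℕ) {k l k' l' : ℕ} (p : Part k l) (q : Part k' l') :
    tensor (T N p) (T N q) = T N (tensorPart p q) := by
  classical
  funext i j
  have hs : Function.Surjective (tensorSplit k l k' l') := by
    rintro ((a | a) | (a | a))
    · exact ⟨Sum.inl (Fin.castAdd _ a), by simp [tensorSplit]⟩
    · exact ⟨Sum.inr (Fin.castAdd _ a), by simp [tensorSplit]⟩
    · exact ⟨Sum.inl (Fin.natAdd _ a), by simp [tensorSplit]⟩
    · exact ⟨Sum.inr (Fin.natAdd _ a), by simp [tensorSplit]⟩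
  have h : Sum.elim j i = Sum.elim
      (Sum.elim (fun a => j (Fin.castAdd k' a)) (fun a => i (Fin.castAdd l' a)))
      (Sum.elim (fun a => j (Fin.natAdd k a)) (fun a => i (Fin.natAdd l a))) ∘
        tensorSplit k l k' l' := by
    funext x
    rcases x with a | a <;> induction a using Fin.addCases <;> simp [tensorSplit]
  rw [tensor, T_apply, T_apply, T_apply, tensorPart, h, compat_comap _ hs, compat_sumSetoid]
  simp only [Sum.elim_inl, Sum.elim_inr]
  rw [ite_zero_mul_ite_zero, one_mul]
  congr

lemma isNonCrossing_tensorPart {k l k' l' : ℕ} {p : Part k l} {q : Part k' l'}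
    (hp : IsNonCrossing p) (hq : IsNonCrossing q) : IsNonCrossing (tensorPart p q) := by
  rw [isNonCrossing_iff] at hp hq ⊢
  -- The order around the juxtaposition: upper points of `p`, then all points of `q`, then lower
  -- points of `p`. The points of `q` are consecutive.
  let o : (Fin k ⊕ Fin l) ⊕ (Fin k' ⊕ Fin l') → ℕ := Sum.elim
    (Sum.elim (fun a => a) (fun b => k + k' + l' + (l - (b + 1))))
    (Sum.elim (fun a => k + a) (fun b => k + k' + (l' - (b + 1))))
  have h : NonCrossingOn o Set.univ (sumSetoid p q) := by
    refine nonCrossingOn_sumSetoid ?_ ?_ ?_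
    · refine hp.comap id (fun _ _ => trivial) ?_
      rintro (a | a) (b | b) h <;> simp only [o, Sum.elim_inl, Sum.elim_inr, id, pos_inl, pos_inr] at h ⊢ <;>
        omega
    · refine hq.comap id (fun _ _ => trivial) ?_
      rintro (a | a) (b | b) h <;> simp only [o, Sum.elim_inl, Sum.elim_inr, id, pos_inl, pos_inr] at h ⊢ <;>
        omega
    · rintro (a | a) (b | b) (c | c) ⟨h, h'⟩ <;> simp only [o, Sum.elim_inl, Sum.elim_inr] at h h' <;>
        omega
  refine h.comap _ (fun _ _ => trivial) ?_
  rintro (a | a) (b | b) h <;> induction a using Fin.addCases <;> induction b using Fin.addCases <;>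
    simp only [tensorSplit, o, Sum.elim_inl, Sum.elim_inr, Fin.addCases_left, Fin.addCases_right,
      pos_inl, pos_inr, Fin.val_castAdd, Fin.val_natAdd] at h ⊢ <;> omega

lemma conjTranspose_T (N : ℕ) {k l : ℕ} (p : Part k l) :
    (T N p).conjTranspose = T N (p.comap Sum.swap : Part l k) := by
  classical
  ext i j
  have h : Sum.elim j i = Sum.elim i j ∘ Sum.swap := by
    funext x; rcases x with a | a <;> rfl
  rw [Matrix.conjTranspose_apply, T_apply, T_apply, h, compat_comap _ Sum.swap_leftInverse.surjective]
  split_ifs <;> simp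

lemma isNonCrossing_comap_swap {k l : ℕ} {p : Part k l} (hp : IsNonCrossing p) :
    IsNonCrossing (p.comap Sum.swap : Part l k) := by
  rw [isNonCrossing_iff] at hp ⊢
  have h : ∀ a b : Fin l ⊕ Fin k, (pos a : ℕ) < pos b → (pos b.swap : ℕ) < pos a.swap := by
    rintro (a | a) (b | b) h <;> simp only [Sum.swap_inl, Sum.swap_inr, pos_inl, pos_inr] at h ⊢ <;>
      omega
  intro a _ b _ c _ d _ hab hbc hcd hac hbd
  have := hp d.swap trivial c.swap trivial b.swap trivial a.swap trivial (h _ _ hcd) (h _ _ hbc)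
    (h _ _ hab) (p.symm hbd) (p.symm hac)
  exact p.trans hac (p.trans (p.symm this) (p.symm hbd))

/-! ### The partition spanned by two monotone maps -/

/-- Along `pos` the values first rise and then fall, so a value between two equal ones is at least
as large. In a crossing this applies to `b` between `a` and `c`, and to `c` between `b` and `d`,
forcing all four values to agree. -/
lemma isNonCrossing_ker {k l m : ℕ} {f : Fin k → Fin m} {g : Fin l → Fin m} (hf : Monotone f)
    (hg : Monotone g) : IsNonCrossing (Setoid.ker (Sum.elim f g) : Part k l) := by
  rw [isNonCrossing_iff]
  have hf' : ∀ {a b : Fin k}, (a : ℕ) < b → f a ≤ f b := fun h => hf (Fin.le_def.2 h.le)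
  have hg' : ∀ {a b : Fin l}, k + (l - (a + 1)) < k + (l - (b + 1)) → g b ≤ g a :=
    fun h => hg (Fin.le_def.2 (by omega))
  rintro a - b - c - d - hab hbc hcd hac hbd
  change Sum.elim f g a = Sum.elim f g c at hac
  change Sum.elim f g b = Sum.elim f g d at hbd
  change Sum.elim f g a = Sum.elim f g b
  rcases a with a | a <;> rcases b with b | b <;> rcases c with c | c <;> rcases d with d | d <;>
    simp only [pos_inl, pos_inr, Sum.elim_inl, Sum.elim_inr] at * <;>
    first
      | exact le_antisymm (by have := hf' hab; order) (by have := hf' hbc; order)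
      | omega
      | (have := hg' hcd; have := hf' hab; order)
      | (have := hg' hcd; have := hg' hbc; order)

lemma ker_sum_elim_compat {N k l m : ℕ} (f : Fin k → Fin m) (g : Fin l → Fin m)
    (x : Fin k ⊕ Fin l → Fin N) :
    Compat (Setoid.ker (Sum.elim f g)) x ↔ ∀ a b, Sum.elim f g a = Sum.elim f g b → x a = x b :=
  Iff.rfl

lemma one_eq_T (N k : ℕ) : (1 : Mat N k k) = T N (Setoid.ker (Sum.elim id id) : Part k k) := by
  classical
  ext i j
  rw [Matrix.one_apply, T_apply]
  congr 1
  rw [ker_sum_elim_compat, eq_iff_iff]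
  constructor
  · rintro rfl (a | a) (b | b) h <;> simp_all
  · exact fun h => funext fun a => h (Sum.inr a) (Sum.inl a) rfl

lemma cup_eq_T (N : ℕ) :
    cup N = T N (Setoid.ker (Sum.elim (fun _ => 0) Fin.elim0 : Fin 2 ⊕ Fin 0 → Fin 1) : Part 2 0) := by
  classical
  funext i j
  rw [cup, T_apply]
  congr 1
  rw [ker_sum_elim_compat, eq_iff_iff]
  constructor
  · intro h
    have : ∀ a, j a = j 0 := by
      intro a; fin_cases a
      · rfl
      · exact h.symm
    rintro (a | a) (b | b) _
    · simp [this a, this b]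
    · exact b.elim0
    · exact a.elim0
    · exact b.elim0
  · exact fun h => h (Sum.inl 0) (Sum.inl 1) rfl

/-! ### The two Tannaka–Krein duals -/

lemma tensor_add_left {N k l k' l' : ℕ} (A A' : Mat N k l) (B : Mat N k' l') :
    tensor (A + A') B = tensor A B + tensor A' B := by
  funext i j; simp [tensor, add_mul]

lemma tensor_add_right {N k l k' l' : ℕ} (A : Mat N k l) (B B' : Mat N k' l') :
    tensor A (B + B') = tensor A B + tensor A B' := by
  funext i j; simp [tensor, mul_add]

lemma tensor_smul_left {N k l k' l' : ℕ} (c : ℂ) (A : Mat N k l) (B : Mat N k' l') :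
    tensor (c • A) B = c • tensor A B := by
  funext i j; simp [tensor, mul_assoc]

lemma tensor_smul_right {N k l k' l' : ℕ} (c : ℂ) (A : Mat N k l) (B : Mat N k' l') :
    tensor A (c • B) = c • tensor A B := by
  funext i j; simp [tensor, mul_left_comm]

lemma tensor_zero_left {N k l k' l' : ℕ} (B : Mat N k' l') :
    tensor (0 : Mat N k l) B = 0 := by
  funext i j; simp [tensor]

lemma tensor_zero_right {N k l k' l' : ℕ} (A : Mat N k l) :
    tensor A (0 : Mat N k' l') = 0 := by
  funext i j; simp [tensor]

/-- A family of partitions closed under the categorical operations spans a Tannaka–Krein dual. -/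
lemma isTannakaKreinDual_span {N : ℕ} (Q : ∀ {k l : ℕ}, Part k l → Prop)
    (htensor : ∀ {k l k' l' : ℕ} {p : Part k l} {q : Part k' l'}, Q p → Q q → Q (tensorPart p q))
    (hcomp : ∀ {k l r : ℕ} {p : Part l r} {q : Part k l}, Q p → Q q → Q (compPart p q))
    (hadj : ∀ {k l : ℕ} {p : Part k l}, Q p → Q (p.comap Sum.swap : Part l k))
    (hker : ∀ {k l m : ℕ} {f : Fin k → Fin m} {g : Fin l → Fin m}, Monotone f → Monotone g →
      Q (Setoid.ker (Sum.elim f g) : Part k l)) :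
    IsTannakaKreinDual
      (fun k l => Submodule.span ℂ {A : Mat N k l | ∃ p : Part k l, Q p ∧ A = T N p}) where
  tensor_mem := by
    intro k l k' l' A B hA hB
    induction hA using Submodule.span_induction with
    | mem A hA =>
      obtain ⟨p, hp, rfl⟩ := hA
      induction hB using Submodule.span_induction with
      | mem B hB =>
        obtain ⟨q, hq, rfl⟩ := hB
        exact Submodule.subset_span ⟨_, htensor hp hq, tensor_T N p q⟩
      | zero => rw [tensor_zero_right]; exact Submodule.zero_mem _
      | add B B' _ _ h h' => rw [tensor_add_right]; exact Submodule.add_mem _ h h'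
      | smul c B _ h => rw [tensor_smul_right]; exact Submodule.smul_mem _ c h
    | zero => rw [tensor_zero_left]; exact Submodule.zero_mem _
    | add A A' _ _ h h' => rw [tensor_add_left]; exact Submodule.add_mem _ h h'
    | smul c A _ h => rw [tensor_smul_left]; exact Submodule.smul_mem _ c h
  comp_mem := by
    intro k l r A B hA hB
    induction hA using Submodule.span_induction with
    | mem A hA =>
      obtain ⟨p, hp, rfl⟩ := hA
      induction hB using Submodule.span_induction with
      | mem B hB =>
        obtain ⟨q, hq, rfl⟩ := hB
        obtain ⟨c, hc⟩ := T_mul_T N p q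
        rw [hc]
        exact Submodule.smul_mem _ _ (Submodule.subset_span ⟨_, hcomp hp hq, rfl⟩)
      | zero => rw [Matrix.mul_zero]; exact Submodule.zero_mem _
      | add B B' _ _ h h' => rw [Matrix.mul_add]; exact Submodule.add_mem _ h h'
      | smul c B _ h => rw [Matrix.mul_smul]; exact Submodule.smul_mem _ c h
    | zero => rw [Matrix.zero_mul]; exact Submodule.zero_mem _
    | add A A' _ _ h h' => rw [Matrix.add_mul]; exact Submodule.add_mem _ h h'
    | smul c A _ h => rw [Matrix.smul_mul]; exact Submodule.smul_mem _ c h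
  adjoint_mem := by
    intro k l A hA
    induction hA using Submodule.span_induction with
    | mem A hA =>
      obtain ⟨p, hp, rfl⟩ := hA
      exact Submodule.subset_span ⟨_, hadj hp, conjTranspose_T N p⟩
    | zero => rw [Matrix.conjTranspose_zero]; exact Submodule.zero_mem _
    | add A A' _ _ h h' => rw [Matrix.conjTranspose_add]; exact Submodule.add_mem _ h h'
    | smul c A _ h => rw [Matrix.conjTranspose_smul]; exact Submodule.smul_mem _ _ h
  id_mem := Submodule.subset_span ⟨_, hker monotone_id monotone_id, one_eq_T N 1⟩
  cup_mem := Submodule.subset_span ⟨_, hker monotone_const (fun a => a.elim0), cup_eq_T N⟩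

lemma isTannakaKreinDual_catNC (N : ℕ) : IsTannakaKreinDual (catNC N) :=
  isTannakaKreinDual_span IsNonCrossing isNonCrossing_tensorPart isNonCrossing_compPart
    isNonCrossing_comap_swap isNonCrossing_ker

lemma isTannakaKreinDual_catP (N : ℕ) : IsTannakaKreinDual (catP N) := by
  have h := isTannakaKreinDual_span (N := N) (fun {k l} (_ : Part k l) => True)
    (fun _ _ => trivial) (fun _ _ => trivial) (fun _ => trivial) (fun _ _ => trivial)
  simp only [true_and] at h
  exact h

lemma catNC_le_catP (N : ℕ) : catNC N ≤ catP N :=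
  fun _ _ => Submodule.span_mono fun _ ⟨p, _, hp⟩ => ⟨p, hp⟩

end TannakaKrein

end

noncomputable section

namespace TannakaKrein

open Finset

/-! ### Tannaka–Krein duals containing the non-crossing partitions -/

/-- The matrix of the pullback of tensors along a map of indices. -/
def pullMat (N : ℕ) {k m : ℕ} (f : Fin k → Fin m) : Mat N k m :=
  fun x j => if j = x ∘ f then 1 else 0

lemma pullMat_eq_T (N : ℕ) {k m : ℕ} (f : Fin k → Fin m) :
    pullMat N f = T N (Setoid.ker (Sum.elim f id) : Part k m) := by
  classical
  funext x j
  rw [pullMat, T_apply]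
  congr 1
  rw [ker_sum_elim_compat, eq_iff_iff]
  constructor
  · rintro rfl (a | a) (b | b) h <;> simp_all
  · exact fun h => funext fun a => h (Sum.inl a) (Sum.inr (f a)) rfl

lemma pullMat_mul_apply {N k l m : ℕ} (f : Fin l → Fin m) (A : Mat N k l) (x : MIdx N m)
    (j : MIdx N k) : (pullMat N f * A) x j = A (x ∘ f) j := by
  simp [Matrix.mul_apply, pullMat]

lemma pullMat_mul_pullMat (N : ℕ) {k l m : ℕ} (f : Fin l → Fin m) (g : Fin k → Fin l) :
    pullMat N f * pullMat N g = pullMat N (f ∘ g) := by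
  ext x j
  rw [pullMat_mul_apply]
  rfl

lemma pullMat_id (N k : ℕ) : pullMat N (id : Fin k → Fin k) = 1 := by
  ext x j
  simp [pullMat, Matrix.one_apply, eq_comm]

lemma conjTranspose_pullMat_mul_apply {N k l m : ℕ} (f : Fin m → Fin l) (A : Mat N k l)
    (x : MIdx N m) (j : MIdx N k) :
    ((pullMat N f).conjTranspose * A) x j = ∑ y : MIdx N l, if x = y ∘ f then A y j else 0 := by
  rw [Matrix.mul_apply]
  refine Finset.sum_congr rfl fun y _ => ?_
  rw [Matrix.conjTranspose_apply, pullMat]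
  split_ifs <;> simp

section

variable {N : ℕ} {D : HomFamily N}

lemma pullMat_mem_of_monotone (hNC : catNC N ≤ D) {k m : ℕ} {f : Fin k → Fin m}
    (hf : Monotone f) : pullMat N f ∈ D k m :=
  hNC k m (Submodule.subset_span ⟨_, isNonCrossing_ker hf monotone_id, pullMat_eq_T N f⟩)

lemma one_mem (hNC : catNC N ≤ D) (k : ℕ) : (1 : Mat N k k) ∈ D k k :=
  pullMat_id N k ▸ pullMat_mem_of_monotone hNC monotone_id

/-- `predAbove` is monotone and glues the neighbours `i` and `i + 1`. -/
lemma merge_mem (hD : IsTannakaKreinDual D) (hNC : catNC N ≤ D) {k n : ℕ} {A : Mat N k (n + 1)}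
    (hA : A ∈ D k (n + 1)) (i : Fin n) :
    (fun x j => A (x ∘ i.predAbove) j : Mat N k n) ∈ D k n := by
  have h := hD.comp_mem (pullMat_mem_of_monotone hNC (Fin.predAbove_right_monotone i)) hA
  refine (congrArg (· ∈ D k n) ?_).mpr h
  funext x j
  rw [pullMat_mul_apply]

/-- The adjoint of the pullback along `succAbove` sums over the colour of the omitted point. -/
lemma delete_mem (hD : IsTannakaKreinDual D) (hNC : catNC N ≤ D) {k n : ℕ} {A : Mat N k (n + 1)}
    (hA : A ∈ D k (n + 1)) (i : Fin (n + 1)) :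
    (fun x j => ∑ u : Fin N, A (i.insertNth u x) j : Mat N k n) ∈ D k n := by
  have h := hD.comp_mem (hD.adjoint_mem (pullMat_mem_of_monotone hNC
    (Fin.strictMono_succAbove i).monotone)) hA
  refine (congrArg (· ∈ D k n) ?_).mpr h
  funext x j
  rw [conjTranspose_pullMat_mul_apply]
  refine Eq.trans ?_ ((Fin.insertNthEquiv (fun _ => Fin N) i).sum_comp _)
  rw [Fintype.sum_prod_type]
  refine Finset.sum_congr rfl fun u _ => ?_
  have : ∀ y : Fin n → Fin N, x = (Fin.insertNthEquiv (fun _ => Fin N) i (u, y)) ∘ i.succAbove ↔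
      x = y := by
    intro y
    rw [show (Fin.insertNthEquiv (fun _ => Fin N) i (u, y)) ∘ i.succAbove = y from
      funext fun a => by simp]
  simp only [this, Finset.sum_ite_eq, Finset.mem_univ, if_true]
  rfl

/-! ### From the crossing of four points to all partitions -/

/-- The vector of the crossing partition of four points. -/
def crossVec (N : ℕ) : Mat N 0 4 := fun x _ => if x 0 = x 2 ∧ x 1 = x 3 then 1 else 0

/-- The flip of two tensor factors. -/
def swapMat (N : ℕ) : Mat N 2 2 := fun i j => if i 0 = j 1 ∧ i 1 = j 0 then 1 else 0

/-- Two identity strands are placed to the left of the crossing. Gluing and summing out points 1 and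
2, and then the two points that have become leftmost, connects the strands to the first two legs and
so turns these legs upwards. -/
lemma swapMat_mem (hD : IsTannakaKreinDual D) (hNC : catNC N ≤ D) (hc : crossVec N ∈ D 0 4) :
    swapMat N ∈ D 2 2 := by
  have h0 : (tensor (1 : Mat N 2 2) (crossVec N) : Mat N 2 6) ∈ D 2 6 :=
    hD.tensor_mem (one_mem hNC 2) hc
  have h4 := delete_mem hD hNC (merge_mem hD hNC (delete_mem hD hNC (merge_mem hD hNC h0 1) 1) 0) 0
  refine (congrArg (· ∈ D 2 2) ?_).mpr h4
  funext x j
  have key : ∀ w u : Fin N, tensor (1 : Mat N 2 2) (crossVec N)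
      ((Fin.insertNth 1 u ((Fin.insertNth 0 w x : Fin 3 → Fin N) ∘ Fin.predAbove (0 : Fin 3)) :
        Fin 5 → Fin N) ∘ Fin.predAbove (1 : Fin 5)) j =
      if w = j 0 then (if u = j 1 then (if x 0 = j 1 ∧ x 1 = j 0 then 1 else 0) else 0) else 0 := by
    intro w u
    set z := ((Fin.insertNth 1 u ((Fin.insertNth 0 w x : Fin 3 → Fin N) ∘
      Fin.predAbove (0 : Fin 3)) : Fin 5 → Fin N) ∘ Fin.predAbove (1 : Fin 5)) with hz
    have z0 : z 0 = w := rfl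
    have z1 : z 1 = u := rfl
    have z2 : z 2 = u := rfl
    have z3 : z 3 = w := rfl
    have z4 : z 4 = x 0 := rfl
    have z5 : z 5 = x 1 := rfl
    have e1 : ((fun a => z (Fin.castAdd 4 a)) = fun b => j (Fin.castAdd 0 b)) ↔
        w = j 0 ∧ u = j 1 := by
      rw [funext_iff, Fin.forall_fin_two]
      exact Iff.rfl
    have e2 : crossVec N (fun a => z (Fin.natAdd 2 a)) (fun b => j (Fin.natAdd 2 b)) =
        if u = x 0 ∧ w = x 1 then 1 else 0 := rfl
    change (1 : Mat N 2 2) (fun a => z (Fin.castAdd 4 a)) (fun b => j (Fin.castAdd 0 b)) *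
      crossVec N (fun a => z (Fin.natAdd 2 a)) (fun b => j (Fin.natAdd 2 b)) = _
    rw [e2, Matrix.one_apply]
    simp only [e1]
    split_ifs <;> simp_all
  simp only [key]
  simp [swapMat]

lemma pullMat_swap_mem (hD : IsTannakaKreinDual D) (hNC : catNC N ≤ D) (hs : swapMat N ∈ D 2 2)
    {n : ℕ} (i : Fin n) : pullMat N (Equiv.swap i.castSucc i.succ) ∈ D (n + 1) (n + 1) := by
  obtain ⟨i, hi⟩ := i
  obtain ⟨b, hb⟩ : ∃ b, n + 1 = i + (2 + b) := ⟨n - i - 1, by omega⟩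
  -- The swap is the flip between `i` and `b` identity strands. The size `m` is a variable so that
  -- its decomposition can be substituted.
  have key : ∀ (m : ℕ) (hm : m = i + (2 + b)) (u v : Fin m), (u : ℕ) = i → (v : ℕ) = i + 1 →
      pullMat N (Equiv.swap u v) ∈ D m m := by
    rintro m rfl u v hu hv
    have h := hD.tensor_mem (one_mem hNC i) (hD.tensor_mem hs (one_mem hNC b))
    convert h using 2
    funext x j
    have hu' : u = Fin.natAdd i (Fin.castAdd b (0 : Fin 2)) := Fin.ext (by simp [hu])
    have hv' : v = Fin.natAdd i (Fin.castAdd b (1 : Fin 2)) := Fin.ext (by simp [hv])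
    have e : (j = x ∘ Equiv.swap u v) ↔
        ((fun a => x (Fin.castAdd (2 + b) a)) = fun a => j (Fin.castAdd (2 + b) a)) ∧
        ((x u = j v ∧ x v = j u) ∧ ((fun a => x (Fin.natAdd i (Fin.natAdd 2 a))) =
          fun a => j (Fin.natAdd i (Fin.natAdd 2 a)))) := by
      have s1 : ∀ a, Equiv.swap u v (Fin.castAdd (2 + b) a) = Fin.castAdd (2 + b) a := fun a =>
        Equiv.swap_apply_of_ne_of_ne (fun h => by have := congrArg Fin.val h; simp at this; omega)
          (fun h => by have := congrArg Fin.val h; simp at this; omega)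
      have s2 : ∀ a, Equiv.swap u v (Fin.natAdd i (Fin.natAdd 2 a)) =
          Fin.natAdd i (Fin.natAdd 2 a) := fun a =>
        Equiv.swap_apply_of_ne_of_ne (fun h => by have := congrArg Fin.val h; simp at this; omega)
          (fun h => by have := congrArg Fin.val h; simp at this; omega)
      constructor
      · rintro rfl
        refine ⟨funext fun a => ?_, ⟨?_, ?_⟩, funext fun a => ?_⟩
        · simp [s1]
        · simp
        · simp
        · simp [s2]
      · rintro ⟨h1, ⟨h2, h3⟩, h4⟩
        funext a
        induction a using Fin.addCases with
        | left a => simpa [s1] using (congrFun h1 a).symm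
        | right a =>
          induction a using Fin.addCases with
          | left a =>
            fin_cases a
            · change j (Fin.natAdd i (Fin.castAdd b (0 : Fin 2))) =
                x (Equiv.swap u v (Fin.natAdd i (Fin.castAdd b (0 : Fin 2))))
              rw [← hu', Equiv.swap_apply_left, h3]
            · change j (Fin.natAdd i (Fin.castAdd b (1 : Fin 2))) =
                x (Equiv.swap u v (Fin.natAdd i (Fin.castAdd b (1 : Fin 2))))
              rw [← hv', Equiv.swap_apply_right, h2]
          | right a => simpa [s2] using (congrFun h4 a).symm
    rw [pullMat, if_congr e rfl rfl]
    simp only [tensor, swapMat, Matrix.one_apply, ite_zero_mul_ite_zero, one_mul, hu', hv']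
  exact key (n + 1) hb _ _ rfl rfl

lemma pullMat_perm_mem (hD : IsTannakaKreinDual D) (hNC : catNC N ≤ D) (hs : swapMat N ∈ D 2 2)
    {n : ℕ} (σ : Equiv.Perm (Fin n)) : pullMat N σ ∈ D n n := by
  cases n with
  | zero =>
    rw [show (σ : Fin 0 → Fin 0) = id from funext fun a => a.elim0]
    exact pullMat_mem_of_monotone hNC monotone_id
  | succ n =>
    have hσ : σ ∈ Submonoid.closure
        (Set.range fun i : Fin n => Equiv.swap i.castSucc i.succ) := by
      rw [Equiv.Perm.mclosure_swap_castSucc_succ]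
      trivial
    induction hσ using Submonoid.closure_induction with
    | mem σ hσ =>
      obtain ⟨i, rfl⟩ := hσ
      exact pullMat_swap_mem hD hNC hs i
    | one => exact pullMat_mem_of_monotone hNC monotone_id
    | mul σ τ _ _ h h' =>
      rw [Equiv.Perm.coe_mul, ← pullMat_mul_pullMat]
      exact hD.comp_mem h h'

lemma pullMat_mem (hD : IsTannakaKreinDual D) (hNC : catNC N ≤ D) (hs : swapMat N ∈ D 2 2)
    {k m : ℕ} (f : Fin k → Fin m) : pullMat N f ∈ D k m := by
  have h : f = (f ∘ Tuple.sort f) ∘ (Tuple.sort f).symm := by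
    funext a; simp
  rw [h, ← pullMat_mul_pullMat]
  exact hD.comp_mem (pullMat_mem_of_monotone hNC (Tuple.monotone_sort f))
    (pullMat_perm_mem hD hNC hs _)

/-- With the blocks numbered by `Fin m`, a colouring is constant on blocks exactly when it factors
through the numbering. The factorization is unique by surjectivity, so the sum in the matrix product
is 0 or 1. -/
lemma exists_T_eq_pullMat (N : ℕ) {k l : ℕ} (p : Part k l) :
    ∃ (m : ℕ) (f : Fin k → Fin m) (g : Fin l → Fin m),
      T N p = (pullMat N g).conjTranspose * pullMat N f := by
  classical
  obtain ⟨m, ⟨e⟩⟩ := Finite.exists_equiv_fin (Quotient p)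
  let h : Fin k ⊕ Fin l → Fin m := fun x => e (Quotient.mk p x)
  have hs : Function.Surjective h := e.surjective.comp Quotient.mk_surjective
  have hp : ∀ x y, p x y ↔ h x = h y := fun x y => by
    simp only [h, e.injective.eq_iff]
    exact Quotient.eq.symm
  refine ⟨m, h ∘ Sum.inl, h ∘ Sum.inr, ?_⟩
  ext i j
  rw [T_apply, conjTranspose_pullMat_mul_apply]
  have e1 : ∀ x : MIdx N m, (if i = x ∘ h ∘ Sum.inr then pullMat N (h ∘ Sum.inl) x j else 0) =
      if Sum.elim j i = x ∘ h then 1 else 0 := by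
    intro x
    rw [pullMat, ← ite_and]
    congr 1
    rw [eq_iff_iff]
    constructor
    · rintro ⟨rfl, rfl⟩
      funext z; rcases z with z | z <;> rfl
    · intro hx
      exact ⟨funext fun a => congrFun hx (Sum.inr a), funext fun a => congrFun hx (Sum.inl a)⟩
  simp only [e1]
  split_ifs with hc
  · let x : MIdx N m := fun b => Sum.elim j i (Function.surjInv hs b)
    have hx : Sum.elim j i = x ∘ h := funext fun z =>
      hc _ _ ((hp _ _).2 (Function.surjInv_eq hs (h z)).symm)
    rw [Finset.sum_eq_single x, if_pos hx]
    · intro y _ hy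
      refine if_neg fun hy' => hy ?_
      exact hs.injective_comp_right (hy'.symm.trans hx)
    · simp
  · symm
    refine Finset.sum_eq_zero fun x _ => if_neg fun hx => hc fun a b hab => ?_
    rw [hx]
    exact congrArg x ((hp a b).1 hab)

lemma catP_le_of_crossVec_mem (hD : IsTannakaKreinDual D) (hNC : catNC N ≤ D)
    (hc : crossVec N ∈ D 0 4) : catP N ≤ D := by
  have hs := swapMat_mem hD hNC hc
  intro k l
  refine Submodule.span_le.2 ?_
  rintro _ ⟨p, rfl⟩
  obtain ⟨m, f, g, h⟩ := exists_T_eq_pullMat N p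
  rw [h]
  exact hD.comp_mem (hD.adjoint_mem (pullMat_mem hD hNC hs g)) (pullMat_mem hD hNC hs f)

end

end TannakaKrein

end

noncomputable section

namespace TannakaKrein

open Finset

/-! ### Crossings and reductions of partitions of a row of points -/

/-- `a < b < c < d` form a crossing of `p`. -/
def CrossAt {n : ℕ} (p : Setoid (Fin n)) (a b c d : Fin n) : Prop :=
  a < b ∧ b < c ∧ c < d ∧ p a c ∧ p b d ∧ ¬ p a b

/-- The partition `p` of a row of points has a crossing. -/
def Crossing {n : ℕ} (p : Setoid (Fin n)) : Prop := ∃ a b c d, CrossAt p a b c d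

/-- Removing the point `i`. -/
abbrev deletePoint {n : ℕ} (p : Setoid (Fin (n + 1))) (i : Fin (n + 1)) : Setoid (Fin n) :=
  p.comap i.succAbove

/-- Identifying the points `i` and `i + 1`. -/
abbrev mergePoints {n : ℕ} (p : Setoid (Fin (n + 1))) (i : Fin n) : Setoid (Fin n) :=
  (joinPair p i.castSucc i.succ).comap i.succ.succAbove

/-- The elementary reductions: identifying neighbours or removing a point. -/
abbrev reduce {n : ℕ} : Fin n ⊕ Fin (n + 1) → Setoid (Fin (n + 1)) → Setoid (Fin n)
  | Sum.inl i, p => mergePoints p i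
  | Sum.inr i, p => deletePoint p i

/-- `mergePoints` is defined by omitting `i + 1`. Going down by `predAbove` and back up moves a
point only within its joined block, which gives this symmetric description as a quotient. -/
lemma mergePoints_predAbove {n : ℕ} (p : Setoid (Fin (n + 1))) (i : Fin n) (x y : Fin (n + 1)) :
    mergePoints p i (i.predAbove x) (i.predAbove y) ↔ joinPair p i.castSucc i.succ x y := by
  have h : ∀ x, joinPair p i.castSucc i.succ x (i.succ.succAbove (i.predAbove x)) := by
    intro x
    by_cases hx : x = i.succ
    · subst hx
      rw [Fin.predAbove_succ_self, Fin.succAbove_succ_self]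
      exact Or.inr ⟨Or.inr (p.refl _), Or.inl (p.refl _)⟩
    · have : i.succ.succAbove (i.predAbove x) = x := by
        rcases lt_or_gt_of_ne hx with hlt | hgt
        · have hle : x ≤ i.castSucc := by
            rw [Fin.le_def]; rw [Fin.lt_def] at hlt; simp at hlt ⊢; omega
          rw [Fin.predAbove_of_le_castSucc _ _ hle, Fin.succAbove_of_castSucc_lt]
          · simp
          · simpa using hlt
        · have hlt' : i.castSucc < x := lt_trans (Fin.castSucc_lt_succ) hgt
          rw [Fin.predAbove_of_castSucc_lt _ _ hlt', Fin.succAbove_of_lt_succ]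
          · simp
          · simpa using hgt
      rw [this]
  constructor
  · intro hxy
    have hxy' : joinPair p i.castSucc i.succ (i.succ.succAbove (i.predAbove x))
      (i.succ.succAbove (i.predAbove y)) := hxy
    exact Setoid.trans' _ (h x) (Setoid.trans' _ hxy' (Setoid.symm' _ (h y)))
  · intro hxy
    exact (show joinPair p i.castSucc i.succ (i.succ.succAbove (i.predAbove x))
      (i.succ.succAbove (i.predAbove y)) from
      Setoid.trans' _ (Setoid.symm' _ (h x)) (Setoid.trans' _ hxy (h y)))

/-- `predAbove` is monotone and glues only points of one joined block, while consecutive points of a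
crossing lie in different blocks; so the order of the four points stays strict. -/
lemma crossing_mergePoints {n : ℕ} {p : Setoid (Fin (n + 1))} {i : Fin n} {a b c d : Fin (n + 1)}
    (h : CrossAt (joinPair p i.castSucc i.succ) a b c d) : Crossing (mergePoints p i) := by
  obtain ⟨hab, hbc, hcd, hac, hbd, hn⟩ := h
  have hne : ∀ x y, ¬ joinPair p i.castSucc i.succ x y → x < y →
      i.predAbove x < i.predAbove y := by
    intro x y hxy hlt
    refine lt_of_le_of_ne (Fin.predAbove_right_monotone i hlt.le) fun e => hxy ?_
    rw [← mergePoints_predAbove, e]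
  refine ⟨i.predAbove a, i.predAbove b, i.predAbove c, i.predAbove d, hne _ _ hn hab,
    hne _ _ (fun h => hn (Setoid.trans' _ hac (Setoid.symm' _ h))) hbc,
    hne _ _ (fun h => hn (Setoid.trans' _ hac (Setoid.trans' _ h (Setoid.symm' _ hbd)))) hcd,
    (mergePoints_predAbove _ _ _ _).2 hac, (mergePoints_predAbove _ _ _ _).2 hbd,
    fun h => hn ((mergePoints_predAbove _ _ _ _).1 h)⟩

lemma crossing_deletePoint {n : ℕ} {p : Setoid (Fin (n + 1))} {i a b c d : Fin (n + 1)}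
    (h : CrossAt p a b c d) (ha : a ≠ i) (hb : b ≠ i) (hc : c ≠ i) (hd : d ≠ i) :
    Crossing (deletePoint p i) := by
  obtain ⟨a, rfl⟩ := Fin.exists_succAbove_eq ha
  obtain ⟨b, rfl⟩ := Fin.exists_succAbove_eq hb
  obtain ⟨c, rfl⟩ := Fin.exists_succAbove_eq hc
  obtain ⟨d, rfl⟩ := Fin.exists_succAbove_eq hd
  obtain ⟨hab, hbc, hcd, hac, hbd, hn⟩ := h
  exact ⟨a, b, c, d, Fin.succAbove_lt_succAbove_iff.1 hab, Fin.succAbove_lt_succAbove_iff.1 hbc,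
    Fin.succAbove_lt_succAbove_iff.1 hcd, hac, hbd, hn⟩

lemma iff_of_deletePoint_eq {n : ℕ} {p q : Setoid (Fin (n + 1))} {i x y : Fin (n + 1)}
    (h : deletePoint p i = deletePoint q i) (hx : x ≠ i) (hy : y ≠ i) : p x y ↔ q x y := by
  obtain ⟨x, rfl⟩ := Fin.exists_succAbove_eq hx
  obtain ⟨y, rfl⟩ := Fin.exists_succAbove_eq hy
  exact Setoid.ext_iff.1 h x y

/-! ### Partitions of five points -/

/-- The ten crossing partitions of five points, as kernels of maps. -/
def fiveCross : Fin 10 → Fin 5 → Fin 3 :=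
  -- For `w < 5`, row `w` has the singleton `w`; row `5 + j` has the three-point block `j`, `j + 1`,
  -- `j + 3` modulo 5.
  ![![2, 0, 1, 0, 1], ![0, 2, 1, 0, 1], ![0, 1, 2, 0, 1], ![0, 1, 0, 2, 1], ![0, 1, 0, 1, 2],
    ![0, 0, 1, 0, 1], ![1, 0, 0, 1, 0], ![0, 1, 0, 0, 1], ![1, 0, 1, 0, 0], ![0, 1, 0, 1, 0]]

/-- Which of the ten crossing partitions of five points stay crossing under a reduction. -/
def fiveTable (R : Fin 4 ⊕ Fin 5) (w : Fin 10) : Bool :=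
  -- Bit `w` of the number attached to `R` belongs to row `w` of `fiveCross`.
  Nat.testBit (Sum.elim ![35, 70, 140, 280] ![545, 98, 196, 392, 784] R) w

lemma crossing_four_iff (p : Setoid (Fin 4)) : Crossing p ↔ p 0 2 ∧ p 1 3 ∧ ¬ p 0 1 := by
  constructor
  · rintro ⟨a, b, c, d, hab, hbc, hcd, h⟩
    have : ∀ a b c d : Fin 4, a < b → b < c → c < d → a = 0 ∧ b = 1 ∧ c = 2 ∧ d = 3 := by decide
    obtain ⟨rfl, rfl, rfl, rfl⟩ := this a b c d hab hbc hcd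
    exact h
  · exact fun h => ⟨0, 1, 2, 3, by decide, by decide, by decide, h⟩

lemma eq_ker_of_crossing_four {p : Setoid (Fin 4)} (h : Crossing p) :
    p = Setoid.ker (![0, 1, 0, 1] : Fin 4 → Fin 2) := by
  obtain ⟨h1, h2, h3⟩ := (crossing_four_iff p).1 h
  have e : ∀ x y, p x y ↔ Quotient.mk p x = Quotient.mk p y := fun x y => Quotient.eq.symm
  ext x y
  change p x y ↔ (![0, 1, 0, 1] : Fin 4 → Fin 2) x = (![0, 1, 0, 1] : Fin 4 → Fin 2) y
  rw [e] at h1 h2 h3 ⊢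
  fin_cases x <;> fin_cases y <;> simp <;> grind

lemma fiveTable_inl (i : Fin 4) (w : Fin 10) :
    fiveTable (Sum.inl i) w = true ↔ Crossing (mergePoints (Setoid.ker (fiveCross w)) i) := by
  let r (i : Fin 4) (w : Fin 10) (x y : Fin 4) : Prop :=
    fiveCross w (i.succ.succAbove x) = fiveCross w (i.succ.succAbove y) ∨
      ((fiveCross w (i.succ.succAbove x) = fiveCross w i.castSucc ∨
        fiveCross w (i.succ.succAbove x) = fiveCross w i.succ) ∧
       (fiveCross w (i.succ.succAbove y) = fiveCross w i.castSucc ∨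
        fiveCross w (i.succ.succAbove y) = fiveCross w i.succ))
  rw [crossing_four_iff]
  change _ ↔ r i w 0 2 ∧ r i w 1 3 ∧ ¬ r i w 0 1
  revert i w
  decide

lemma fiveTable_inr (i : Fin 5) (w : Fin 10) :
    fiveTable (Sum.inr i) w = true ↔ Crossing (deletePoint (Setoid.ker (fiveCross w)) i) := by
  let r (i : Fin 5) (w : Fin 10) (x y : Fin 4) : Prop :=
    fiveCross w (i.succAbove x) = fiveCross w (i.succAbove y)
  rw [crossing_four_iff]
  change _ ↔ r i w 0 2 ∧ r i w 1 3 ∧ ¬ r i w 0 1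
  revert i w
  decide

lemma fiveTable_iff (R : Fin 4 ⊕ Fin 5) (w : Fin 10) :
    fiveTable R w = true ↔ Crossing (reduce R (Setoid.ker (fiveCross w))) := by
  rcases R with i | i
  · exact fiveTable_inl i w
  · exact fiveTable_inr i w

set_option maxRecDepth 100000 in
-- A finite check over all triples. Repetitions among `a`, `b`, `c` are allowed, which covers sets
-- of one or two partitions as well.
lemma fiveTable_separates (a b c : Fin 10) : ∃ R : Fin 4 ⊕ Fin 5, ∃ w : Fin 10,
    (w = a ∨ w = b ∨ w = c) ∧ fiveTable R w = true ∧
      ∀ w', (w' = a ∨ w' = b ∨ w' = c) → fiveTable R w' = true → w' = w := by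
  have key : ∀ a b c : Fin 10, ∃ R : Fin 4 ⊕ Fin 5,
      (fiveTable R a && (!fiveTable R b || a == b) && (!fiveTable R c || a == c)) ||
      (fiveTable R b && (!fiveTable R a || b == a) && (!fiveTable R c || b == c)) ||
      (fiveTable R c && (!fiveTable R a || c == a) && (!fiveTable R b || c == b)) := by
    decide +kernel
  obtain ⟨R, hR⟩ := key a b c
  refine ⟨R, ?_⟩
  simp only [Bool.or_eq_true, Bool.and_eq_true, Bool.not_eq_true', beq_iff_eq] at hR
  rcases hR with (⟨⟨h1, h2⟩, h3⟩ | ⟨⟨h1, h2⟩, h3⟩) | ⟨⟨h1, h2⟩, h3⟩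
  · exact ⟨a, by simp, h1, by grind⟩
  · exact ⟨b, by simp, h1, by grind⟩
  · exact ⟨c, by simp, h1, by grind⟩

set_option synthInstance.maxSize 1000 in
set_option synthInstance.maxHeartbeats 200000 in
-- The crossing uses all points but one, `e`, and `p` is determined by `e` and by whether `e` is
-- alone, in the first block or in the second.
lemma exists_eq_fiveCross {p : Setoid (Fin 5)} (h : Crossing p) :
    ∃ w, p = Setoid.ker (fiveCross w) := by
  obtain ⟨a, b, c, d, hab, hbc, hcd, hac, hbd, hn⟩ := h
  have h1 : ∀ a b c d : Fin 5, a < b → b < c → c < d → ∃ e : Fin 5,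
      a = e.succAbove 0 ∧ b = e.succAbove 1 ∧ c = e.succAbove 2 ∧ d = e.succAbove 3 := by decide
  have hcover : ∀ e x : Fin 5, x = e.succAbove 0 ∨ x = e.succAbove 1 ∨ x = e.succAbove 2 ∨
      x = e.succAbove 3 ∨ x = e := by decide
  obtain ⟨e, rfl, rfl, rfl, rfl⟩ := h1 a b c d hab hbc hcd
  have hq : ∀ x y, p x y ↔ Quotient.mk p x = Quotient.mk p y := fun x y => Quotient.eq.symm
  have key : ∀ f : Fin 5 → Fin 3, f (e.succAbove 0) = f (e.succAbove 2) →
      f (e.succAbove 1) = f (e.succAbove 3) → f (e.succAbove 0) ≠ f (e.succAbove 1) →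
      (f e = f (e.succAbove 0) ↔ p e (e.succAbove 0)) →
      (f e = f (e.succAbove 1) ↔ p e (e.succAbove 1)) → p = Setoid.ker f := by
    intro f f1 f2 f3 f4 f5
    ext x y
    change p x y ↔ f x = f y
    rw [hq] at *
    rcases hcover e x with rfl | rfl | rfl | rfl | hx <;>
      rcases hcover e y with rfl | rfl | rfl | rfl | hy <;> grind
  by_cases g1 : p e (e.succAbove 0)
  · have g2 : ¬ p e (e.succAbove 1) := fun g => hn (p.trans (p.symm g1) g)
    have : ∀ e : Fin 5, ∃ w, fiveCross w (e.succAbove 0) = fiveCross w (e.succAbove 2) ∧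
      fiveCross w (e.succAbove 1) = fiveCross w (e.succAbove 3) ∧
      fiveCross w (e.succAbove 0) ≠ fiveCross w (e.succAbove 1) ∧
      fiveCross w e = fiveCross w (e.succAbove 0) ∧
      fiveCross w e ≠ fiveCross w (e.succAbove 1) := by decide
    obtain ⟨w, w1, w2, w3, w4, w5⟩ := this e
    exact ⟨w, key _ w1 w2 w3 (iff_of_true w4 g1) (iff_of_false w5 g2)⟩
  · by_cases g2 : p e (e.succAbove 1)
    · have : ∀ e : Fin 5, ∃ w, fiveCross w (e.succAbove 0) = fiveCross w (e.succAbove 2) ∧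
        fiveCross w (e.succAbove 1) = fiveCross w (e.succAbove 3) ∧
        fiveCross w (e.succAbove 0) ≠ fiveCross w (e.succAbove 1) ∧
        fiveCross w e ≠ fiveCross w (e.succAbove 0) ∧
        fiveCross w e = fiveCross w (e.succAbove 1) := by decide
      obtain ⟨w, w1, w2, w3, w4, w5⟩ := this e
      exact ⟨w, key _ w1 w2 w3 (iff_of_false w4 g1) (iff_of_true w5 g2)⟩
    · have : ∀ e : Fin 5, ∃ w, fiveCross w (e.succAbove 0) = fiveCross w (e.succAbove 2) ∧
        fiveCross w (e.succAbove 1) = fiveCross w (e.succAbove 3) ∧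
        fiveCross w (e.succAbove 0) ≠ fiveCross w (e.succAbove 1) ∧
        fiveCross w e ≠ fiveCross w (e.succAbove 0) ∧
        fiveCross w e ≠ fiveCross w (e.succAbove 1) := by decide
      obtain ⟨w, w1, w2, w3, w4, w5⟩ := this e
      exact ⟨w, key _ w1 w2 w3 (iff_of_false w4 g1) (iff_of_false w5 g2)⟩

/-! ### Separating at most three crossing partitions -/

/-- On five points more is true: some reduction keeps exactly one of the partitions crossing, which
separates its image from the others. -/
lemma exists_separating_reduce_five {S : Finset (Setoid (Fin 5))} (hS : S.Nonempty)
    (hcard : #S ≤ 3) (hc : ∀ p ∈ S, Crossing p) : ∃ R, ∃ p ∈ S, Crossing (reduce R p) ∧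
      ∀ p' ∈ S, reduce R p' = reduce R p → p' = p := by
  classical
  have h3 : ∃ x y z, S = {x, y, z} := by
    have hpos := hS.card_pos
    rcases (by omega : #S = 1 ∨ #S = 2 ∨ #S = 3) with h | h | h
    · obtain ⟨x, rfl⟩ := Finset.card_eq_one.1 h
      exact ⟨x, x, x, by simp⟩
    · obtain ⟨x, y, -, rfl⟩ := Finset.card_eq_two.1 h
      exact ⟨x, x, y, by simp⟩
    · obtain ⟨x, y, z, -, -, -, rfl⟩ := Finset.card_eq_three.1 h
      exact ⟨x, y, z, rfl⟩
  obtain ⟨x, y, z, rfl⟩ := h3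
  obtain ⟨a, rfl⟩ := exists_eq_fiveCross (hc x (by simp))
  obtain ⟨b, rfl⟩ := exists_eq_fiveCross (hc y (by simp))
  obtain ⟨c, rfl⟩ := exists_eq_fiveCross (hc z (by simp))
  obtain ⟨R, w, hw, hRw, huniq⟩ := fiveTable_separates a b c
  refine ⟨R, Setoid.ker (fiveCross w), ?_, (fiveTable_iff R w).1 hRw, fun p' hp' he => ?_⟩
  · rcases hw with rfl | rfl | rfl <;> simp
  · have : ∃ w', (w' = a ∨ w' = b ∨ w' = c) ∧ p' = Setoid.ker (fiveCross w') := by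
      simp only [Finset.mem_insert, Finset.mem_singleton] at hp'
      rcases hp' with h | h | h
      · exact ⟨a, by simp, h⟩
      · exact ⟨b, by simp, h⟩
      · exact ⟨c, by simp, h⟩
    obtain ⟨w', hw', rfl⟩ := this
    rw [huniq w' hw' ((fiveTable_iff R w').2 (he ▸ (fiveTable_iff R w).1 hRw))]

/-- Two partitions agreeing after each reduction that keeps them both crossing, with a common
crossing, are equal. -/
lemma le_of_forall_reduce_eq {n : ℕ} (hn : 5 ≤ n) {p q : Setoid (Fin (n + 1))}
    {a b c d : Fin (n + 1)} (hp : CrossAt p a b c d) (hq : CrossAt q a b c d)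
    (h : ∀ R, Crossing (reduce R p) → Crossing (reduce R q) → reduce R p = reduce R q) :
    p ≤ q := by
  classical
  intro e g hpe
  by_contra hqe
  have hdel : ∀ y, a ≠ y → b ≠ y → c ≠ y → d ≠ y → deletePoint p y = deletePoint q y :=
    fun y h1 h2 h3 h4 => h (Sum.inr y) (crossing_deletePoint hp h1 h2 h3 h4)
      (crossing_deletePoint hq h1 h2 h3 h4)
  -- Any other point could be deleted without destroying the crossing or the disagreement about `e`
  -- and `g`.
  have hcov : ∀ y, y ∈ ({a, b, c, d, e, g} : Finset (Fin (n + 1))) := by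
    intro y
    by_contra hy
    simp only [Finset.mem_insert, Finset.mem_singleton, not_or] at hy
    obtain ⟨y1, y2, y3, y4, y5, y6⟩ := hy
    exact hqe ((iff_of_deletePoint_eq (hdel y (Ne.symm y1) (Ne.symm y2) (Ne.symm y3) (Ne.symm y4))
      (Ne.symm y5) (Ne.symm y6)).1 hpe)
  have hcard : n + 1 ≤ #({a, b, c, d, e, g} : Finset (Fin (n + 1))) := by
    have := Finset.card_le_card (fun y _ => hcov y :
      (Finset.univ : Finset (Fin (n + 1))) ⊆ {a, b, c, d, e, g})
    simpa using this
  have hn5 : n = 5 := by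
    have := Finset.card_le_six (a := a) (b := b) (c := c) (d := d) (e := e) (f := g)
    omega
  subst hn5
  have hle : ∀ s : Finset (Fin 6), ({a, b, c, d, e, g} : Finset (Fin 6)) ⊆ s → 6 ≤ #s :=
    fun s hs => hcard.trans (Finset.card_le_card hs)
  have hnot : ∀ x ∈ ({a, b, c, d} : Finset (Fin 6)), x ≠ e ∧ x ≠ g := by
    intro x hx
    constructor
    · rintro rfl
      have h1 := hle {a, b, c, d, g} (by
        intro y hy
        simp only [Finset.mem_insert, Finset.mem_singleton] at hx hy ⊢
        grind)
      have h2 := Finset.card_le_five (a := a) (b := b) (c := c) (d := d) (e := g)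
      omega
    · rintro rfl
      have h1 := hle {a, b, c, d, e} (by
        intro y hy
        simp only [Finset.mem_insert, Finset.mem_singleton] at hx hy ⊢
        grind)
      have h2 := Finset.card_le_five (a := a) (b := b) (c := c) (d := d) (e := e)
      omega
  have ha := hnot a (by simp)
  have hb := hnot b (by simp)
  have hc := hnot c (by simp)
  have hd := hnot d (by simp)
  have heg : e ≠ g := by
    rintro rfl
    exact hqe (q.refl e)
  have hde := hdel e ha.1 hb.1 hc.1 hd.1
  have hdg := hdel g ha.2 hb.2 hc.2 hd.2
  -- Comparing the deletions of `e` and of `g`: `{e, g}` is a block of `p`, whereas `e` and `g` are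
  -- singletons of `q`.
  have pe : ∀ y, y ≠ e → y ≠ g → ¬ p y e := by
    intro y ye yg hy
    have h1 : q y e := (iff_of_deletePoint_eq hdg yg heg).1 hy
    have h2 : q y g := (iff_of_deletePoint_eq hde ye heg.symm).1 (p.trans hy hpe)
    exact hqe (q.trans (q.symm h1) h2)
  have pg : ∀ y, y ≠ e → y ≠ g → ¬ p y g :=
    fun y ye yg hy => pe y ye yg (p.trans hy (p.symm hpe))
  have qe : ∀ y, y ≠ e → y ≠ g → ¬ q y e :=
    fun y ye yg hy => pe y ye yg ((iff_of_deletePoint_eq hdg yg heg).2 hy)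
  have qg : ∀ y, y ≠ e → y ≠ g → ¬ q y g :=
    fun y ye yg hy => pg y ye yg ((iff_of_deletePoint_eq hde ye heg.symm).2 hy)
  -- One of `e`, `g`, called `t`, has a neighbour `x` outside the pair; the reduction that glues `t`
  -- to `x` will tell `p` from `q`.
  have hi : ∀ e g : Fin 6, e ≠ g → ∃ i : Fin 5, ∃ t x : Fin 6, (t = e ∨ t = g) ∧ x ≠ e ∧ x ≠ g ∧
      ((i.castSucc = t ∧ i.succ = x) ∨ (i.castSucc = x ∧ i.succ = t)) := by decide
  obtain ⟨i, t, x, ht, hxe, hxg, hix⟩ := hi e g heg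
  have hU : ∀ (r : Setoid (Fin 6)) (y : Fin 6),
      (r y i.castSucc ∨ r y i.succ) ↔ (r y t ∨ r y x) := by
    intro r y
    rcases hix with ⟨h1, h2⟩ | ⟨h1, h2⟩ <;> rw [h1, h2]
    exact or_comm
  -- Neither `a` nor `b` is related to `t`, so gluing `t` to `x` could join them only through `x`,
  -- where they would already be related.
  have hcross : ∀ r : Setoid (Fin 6), CrossAt r a b c d → (∀ y, y ≠ e → y ≠ g → ¬ r y e) →
      (∀ y, y ≠ e → y ≠ g → ¬ r y g) → Crossing (mergePoints r i) := by
    rintro r ⟨hab, hbc, hcd, hac, hbd, hnab⟩ re rg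
    refine crossing_mergePoints (a := a) (b := b) (c := c) (d := d)
      ⟨hab, hbc, hcd, Or.inl hac, Or.inl hbd, ?_⟩
    rw [joinPair_apply, hU, hU]
    have hrt : ∀ y, y ≠ e → y ≠ g → ¬ r y t := by
      rcases ht with rfl | rfl
      · exact re
      · exact rg
    rintro (h1 | ⟨h1 | h1, h2 | h2⟩)
    · exact hnab h1
    · exact hrt a ha.1 ha.2 h1
    · exact hrt a ha.1 ha.2 h1
    · exact hrt b hb.1 hb.2 h2
    · exact hnab (r.trans h1 (r.symm h2))
  have hm := h (Sum.inl i) (hcross p hp pe pg) (hcross q hq qe qg)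
  -- The merged `p` relates `e` and `g`, hence so does the merged `q`; but in `q` the gluing only
  -- joins the singleton `t` to the block of `x`, which avoids the other one.
  have hj : joinPair q i.castSucc i.succ e g := by
    rw [← mergePoints_predAbove]
    have h1 : mergePoints p i (i.predAbove e) (i.predAbove g) :=
      (mergePoints_predAbove p i e g).2 (Or.inl hpe)
    exact (Setoid.ext_iff.1 hm _ _).1 h1
  rw [joinPair_apply, hU, hU] at hj
  rcases hj with h1 | ⟨h1, h2⟩
  · exact hqe h1
  · rcases ht with rfl | rfl
    · rcases h2 with h2 | h2
      · exact hqe (q.symm h2)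
      · exact qg x hxe hxg (q.symm h2)
    · rcases h1 with h1 | h1
      · exact hqe h1
      · exact qe x hxe hxg (q.symm h1)

/-- Among at most three crossing partitions of at least five points, there is one that stays crossing
and distinct from the others under some elementary reduction. -/
lemma exists_separating_reduce {n : ℕ} (hn : 4 ≤ n) {S : Finset (Setoid (Fin (n + 1)))}
    (hS : S.Nonempty) (hcard : #S ≤ 3) (hc : ∀ p ∈ S, Crossing p) :
    ∃ R, ∃ p ∈ S, Crossing (reduce R p) ∧ ∀ p' ∈ S, reduce R p' = reduce R p → p' = p := by
  classical
  rcases hn.eq_or_lt with rfl | hn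
  · exact exists_separating_reduce_five hS hcard hc
  by_contra! h
  -- By the negated claim each crossing image has a second preimage, so two different crossing
  -- images would give four members of `S`.
  have hconst : ∀ R, ∀ p ∈ S, ∀ q ∈ S, Crossing (reduce R p) → Crossing (reduce R q) →
      reduce R p = reduce R q := by
    intro R p hp q hq hcp hcq
    by_contra hne
    obtain ⟨p', hp', e1, e2⟩ := h R p hp hcp
    obtain ⟨q', hq', e3, e4⟩ := h R q hq hcq
    have hcard4 : #({p, p', q, q'} : Finset (Setoid (Fin (n + 1)))) = 4 := by
      have d1 : p ≠ q := fun e => hne (by rw [e])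
      have d2 : p ≠ q' := fun e => hne (by rw [e, e3])
      have d3 : p' ≠ q := fun e => hne (by rw [← e1, e])
      have d4 : p' ≠ q' := fun e => hne (by rw [← e1, e, e3])
      rw [Finset.card_insert_of_notMem (by simp [d1, d2, e2.symm]),
        Finset.card_insert_of_notMem (by simp [d3, d4]), Finset.card_pair e4.symm]
    have hsub : ({p, p', q, q'} : Finset (Setoid (Fin (n + 1)))) ⊆ S := by
      intro x hx
      simp only [Finset.mem_insert, Finset.mem_singleton] at hx
      rcases hx with rfl | rfl | rfl | rfl <;> assumption
    have := Finset.card_le_card hsub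
    omega
  obtain ⟨p, hp⟩ := hS
  obtain ⟨a, b, c, d, habcd⟩ := hc p hp
  obtain ⟨y, hy⟩ : ∃ y, y ∉ ({a, b, c, d} : Finset (Fin (n + 1))) := by
    by_contra! hall
    have h1 := Finset.card_le_card (fun y _ => hall y :
      (Finset.univ : Finset (Fin (n + 1))) ⊆ {a, b, c, d})
    have h2 := Finset.card_le_four (a := a) (b := b) (c := c) (d := d)
    simp only [Finset.card_univ, Fintype.card_fin] at h1
    omega
  simp only [Finset.mem_insert, Finset.mem_singleton, not_or] at hy
  obtain ⟨y1, y2, y3, y4⟩ := hy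
  -- Deleting a point off the crossing of `p` yields a partner `q` with the same image, hence with
  -- the same crossing.
  obtain ⟨q, hq, he, hne⟩ := h (Sum.inr y) p hp
    (crossing_deletePoint habcd (Ne.symm y1) (Ne.symm y2) (Ne.symm y3) (Ne.symm y4))
  have hqc : CrossAt q a b c d := by
    obtain ⟨hab, hbc, hcd, hac, hbd, hn⟩ := habcd
    exact ⟨hab, hbc, hcd, (iff_of_deletePoint_eq he (Ne.symm y1) (Ne.symm y3)).2 hac,
      (iff_of_deletePoint_eq he (Ne.symm y2) (Ne.symm y4)).2 hbd,
      fun g => hn ((iff_of_deletePoint_eq he (Ne.symm y1) (Ne.symm y2)).1 g)⟩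
  exact hne (le_antisymm
    (le_of_forall_reduce_eq hn hqc habcd fun R => hconst R q hq p hp)
    (le_of_forall_reduce_eq hn habcd hqc fun R => hconst R p hp q hq))

end TannakaKrein

end

noncomputable section

namespace TannakaKrein

open Finset

/-! ### Reducing linear combinations of at most three partitions -/

/-- A partition of a row of points, seen as a partition with lower points only. -/
abbrev toPart {n : ℕ} (p : Setoid (Fin n)) : Part 0 n := p.comap (Sum.elim Fin.elim0 id)

lemma toPart_comap_inr {n : ℕ} (q : Part 0 n) : toPart (q.comap Sum.inr) = q := by
  ext x y
  rcases x with x | x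
  · exact x.elim0
  rcases y with y | y
  · exact y.elim0
  exact Iff.rfl

lemma isNonCrossing_toPart {n : ℕ} {p : Setoid (Fin n)} (h : ¬ Crossing p) :
    IsNonCrossing (toPart p) := by
  rintro (a | a) (b | b) (c | c) (d | d) ⟨hab, hbc, hcd, hac, hbd, hn⟩
  all_goals try first | exact a.elim0 | exact b.elim0 | exact c.elim0 | exact d.elim0
  rw [Fin.lt_def, pos_inr, pos_inr] at hab hbc hcd
  change p a c at hac
  change p b d at hbd
  change ¬ p a b at hn
  -- `pos` lists lower points from right to left, so the crossing is read backwards.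
  exact h ⟨d, c, b, a, Fin.lt_def.2 (by omega), Fin.lt_def.2 (by omega), Fin.lt_def.2 (by omega),
    p.symm hbd, p.symm hac, fun g => hn (p.trans hac (p.trans (p.symm g) (p.symm hbd)))⟩

open Classical in
lemma xi_toPart_apply (N : ℕ) {n : ℕ} (p : Setoid (Fin n)) (x : MIdx N n) (j : MIdx N 0) :
    xi N (toPart p) x j = if Compat p x then 1 else 0 := by
  refine (T_apply N (toPart p) x j).trans ?_
  congr 1
  rw [eq_iff_iff]
  constructor
  · exact fun h a b hab => h (Sum.inr a) (Sum.inr b) hab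
  · rintro h (a | a) (b | b) hab
    · exact a.elim0
    · exact a.elim0
    · exact b.elim0
    · exact h a b hab

lemma xi_mergePoints (N : ℕ) {n : ℕ} (p : Setoid (Fin (n + 1))) (i : Fin n) (x : MIdx N n)
    (j : MIdx N 0) :
    xi N (toPart p) (x ∘ i.predAbove) j = xi N (toPart (mergePoints p i)) x j := by
  classical
  have hs : Function.Surjective i.predAbove := Fin.predAbove_surjective i
  have h : (mergePoints p i).comap i.predAbove = joinPair p i.castSucc i.succ := by
    ext a b
    exact mergePoints_predAbove p i a b
  rw [xi_toPart_apply, xi_toPart_apply]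
  congr 1
  rw [← compat_comap _ hs, h, compat_joinPair, eq_iff_iff]
  simp

/-- If `i` shares its block with another point its colour is forced and the weight is 1; if `i` is a
singleton its colour is free and the weight is `N`. -/
lemma exists_xi_deletePoint {N : ℕ} (hN : 1 ≤ N) {n : ℕ} (p : Setoid (Fin (n + 1)))
    (i : Fin (n + 1)) : ∃ w : ℂ, w ≠ 0 ∧ ∀ (x : MIdx N n) (j : MIdx N 0),
      ∑ u : Fin N, xi N (toPart p) (i.insertNth u x) j =
        w * xi N (toPart (deletePoint p i)) x j := by
  classical
  have hcompat : ∀ (u : Fin N) (x : MIdx N n), Compat p (i.insertNth u x : Fin (n + 1) → Fin N) ↔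
      Compat (deletePoint p i) x ∧ ∀ y, p i (i.succAbove y) → u = x y := by
    intro u x
    constructor
    · refine fun h => ⟨fun a b hab => ?_, fun y hy => ?_⟩
      · simpa using h _ _ hab
      · simpa using h _ _ hy
    · rintro ⟨h, h'⟩ a b hab
      induction a using Fin.succAboveCases i with
      | x =>
        induction b using Fin.succAboveCases i with
        | x => rfl
        | p b => simpa using h' b hab
      | p a =>
        induction b using Fin.succAboveCases i with
        | x => simpa using (h' a (p.symm hab)).symm
        | p b => simpa using h a b hab
  simp only [xi_toPart_apply, hcompat]
  by_cases hi : ∃ y, p i (i.succAbove y)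
  · obtain ⟨y, hy⟩ := hi
    refine ⟨1, one_ne_zero, fun x j => ?_⟩
    have h : ∀ u, (Compat (deletePoint p i) x ∧ ∀ y, p i (i.succAbove y) → u = x y) ↔
        u = x y ∧ Compat (deletePoint p i) x := by
      refine fun u => ⟨fun h => ⟨h.2 y hy, h.1⟩, ?_⟩
      rintro ⟨rfl, h⟩
      exact ⟨h, fun z hz => h y z (p.trans (p.symm hy) hz)⟩
    simp only [h, ite_and, Finset.sum_ite_eq', Finset.mem_univ, if_true, one_mul]
  · push Not at hi
    refine ⟨N, by exact_mod_cast (by omega : N ≠ 0), fun x j => ?_⟩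
    have h : ∀ u, (Compat (deletePoint p i) x ∧ ∀ y, p i (i.succAbove y) → u = x y) ↔
        Compat (deletePoint p i) x := fun u => ⟨fun h => h.1, fun h => ⟨h, fun y hy => absurd hy (hi y)⟩⟩
    simp only [h, Finset.sum_const, Finset.card_univ, Fintype.card_fin, nsmul_eq_mul]

section

variable {N : ℕ} {D : HomFamily N}

/-- The weights depend only on `R` and on the partition, and their non-vanishing keeps an isolated
coefficient alive. -/
lemma exists_reduce_mem (hN : 1 ≤ N) (hD : IsTannakaKreinDual D) (hNC : catNC N ≤ D) {n : ℕ}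
    (R : Fin n ⊕ Fin (n + 1)) : ∃ w : Setoid (Fin (n + 1)) → ℂ, (∀ p, w p ≠ 0) ∧
      ∀ (S : Finset (Setoid (Fin (n + 1)))) (c : Setoid (Fin (n + 1)) → ℂ),
        ∑ p ∈ S, c p • xi N (toPart p) ∈ D 0 (n + 1) →
          ∑ p ∈ S, (c p * w p) • xi N (toPart (reduce R p)) ∈ D 0 n := by
  rcases R with i | i
  · refine ⟨fun _ => 1, fun _ => one_ne_zero, fun S c h => ?_⟩
    refine (congrArg (· ∈ D 0 n) ?_).mpr (merge_mem hD hNC h i)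
    funext x j
    simp only [Matrix.sum_apply, Matrix.smul_apply, xi_mergePoints, mul_one]
  · choose w hw hw' using fun p => exists_xi_deletePoint hN p i
    refine ⟨w, hw, fun S c h => ?_⟩
    refine (congrArg (· ∈ D 0 n) ?_).mpr (delete_mem hD hNC h i)
    funext x j
    simp only [Matrix.sum_apply, Matrix.smul_apply, smul_eq_mul]
    rw [Finset.sum_comm]
    refine Finset.sum_congr rfl fun p _ => ?_
    rw [← Finset.mul_sum, hw', mul_assoc]

lemma xi_toPart_mem (hNC : catNC N ≤ D) {n : ℕ} {p : Setoid (Fin n)} (hp : ¬ Crossing p) :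
    xi N (toPart p) ∈ D 0 n :=
  hNC 0 n (Submodule.subset_span ⟨_, isNonCrossing_toPart hp, rfl⟩)

/-- A linear combination of at most three partitions that involves a crossing partition generates
the crossing partition of four points. -/
theorem crossVec_mem (hN : 1 ≤ N) (hD : IsTannakaKreinDual D) (hNC : catNC N ≤ D) (n : ℕ) :
    ∀ (S : Finset (Setoid (Fin n))) (c : Setoid (Fin n) → ℂ), #S ≤ 3 →
      ∑ p ∈ S, c p • xi N (toPart p) ∈ D 0 n → (∃ p ∈ S, Crossing p ∧ c p ≠ 0) →
      crossVec N ∈ D 0 4 := by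
  classical
  induction n with
  | zero => rintro S c - - ⟨p, -, ⟨a, -⟩, -⟩; exact a.elim0
  | succ n ih =>
    rintro S c hcard hmem ⟨p₀, hp₀, hcp₀, hc₀⟩
    have hn : 3 ≤ n := by
      obtain ⟨a, b, c, d, hab, hbc, hcd, -⟩ := hcp₀
      rw [Fin.lt_def] at hab hbc hcd
      have := d.2
      omega
    -- Only crossing terms with non-zero coefficient matter; the rest of the sum lies in `D`
    -- already.
    set S' := S.filter fun p => Crossing p ∧ c p ≠ 0 with hS'
    have hcr : ∀ p ∈ S', Crossing p := fun p hp => (Finset.mem_filter.1 hp).2.1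
    have hcard' : #S' ≤ 3 := (Finset.card_filter_le _ _).trans hcard
    have hne : S'.Nonempty := ⟨p₀, Finset.mem_filter.2 ⟨hp₀, hcp₀, hc₀⟩⟩
    have hmem' : ∑ p ∈ S', c p • xi N (toPart p) ∈ D 0 (n + 1) := by
      rw [← Finset.sum_filter_add_sum_filter_not S (fun p => Crossing p ∧ c p ≠ 0)] at hmem
      refine (Submodule.add_mem_iff_left _ ?_).1 hmem
      refine Submodule.sum_mem _ fun p hp => ?_
      have h := (Finset.mem_filter.1 hp).2
      by_cases hc : Crossing p
      · have : c p = 0 := by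
          by_contra h'
          exact h ⟨hc, h'⟩
        rw [this, zero_smul]
        exact Submodule.zero_mem _
      · exact Submodule.smul_mem _ _ (xi_toPart_mem hNC hc)
    rcases hn.eq_or_lt with rfl | hn
    · have hS1 : S' = {p₀} := by
        refine Finset.eq_singleton_iff_unique_mem.2
          ⟨Finset.mem_filter.2 ⟨hp₀, hcp₀, hc₀⟩, fun p hp => ?_⟩
        rw [eq_ker_of_crossing_four (hcr p hp), eq_ker_of_crossing_four hcp₀]
      rw [hS1, Finset.sum_singleton] at hmem'
      have h := Submodule.smul_mem _ (c p₀)⁻¹ hmem'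
      rw [inv_smul_smul₀ hc₀] at h
      refine (congrArg (· ∈ D 0 4) ?_).mpr h
      funext x j
      rw [xi_toPart_apply, crossVec]
      congr 1
      rw [eq_ker_of_crossing_four hcp₀, eq_iff_iff]
      constructor
      · rintro ⟨h1, h2⟩ a b hab
        change (![0, 1, 0, 1] : Fin 4 → Fin 2) a = (![0, 1, 0, 1] : Fin 4 → Fin 2) b at hab
        fin_cases a <;> fin_cases b <;> simp_all
      · exact fun h => ⟨h 0 2 rfl, h 1 3 rfl⟩
    · obtain ⟨R, q, hq, hRq, huniq⟩ := exists_separating_reduce hn hne hcard' hcr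
      obtain ⟨w, hw, hwD⟩ := exists_reduce_mem hN hD hNC R
      -- Partitions with the same reduction are collected, their weighted coefficients being added.
      refine ih (S'.image (reduce R)) (fun r => ∑ p ∈ S' with reduce R p = r, c p * w p)
        (Finset.card_image_le.trans hcard') ?_ ⟨reduce R q, Finset.mem_image_of_mem _ hq, hRq, ?_⟩
      · have h := hwD S' c hmem'
        rw [← Finset.sum_fiberwise_of_maps_to (g := reduce R)
          (fun p hp => Finset.mem_image_of_mem _ hp)] at h
        refine (congrArg (· ∈ D 0 n) ?_).mpr h
        refine Finset.sum_congr rfl fun r _ => ?_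
        rw [Finset.sum_smul]
        refine Finset.sum_congr rfl fun p hp => ?_
        rw [(Finset.mem_filter.1 hp).2]
      · have h1 : (S'.filter fun p => reduce R p = reduce R q) = {q} :=
          Finset.eq_singleton_iff_unique_mem.2 ⟨Finset.mem_filter.2 ⟨hq, rfl⟩, fun p hp =>
            huniq p (Finset.mem_filter.1 hp).1 (Finset.mem_filter.1 hp).2⟩
        change ∑ p ∈ S' with reduce R p = reduce R q, c p * w p ≠ 0
        rw [h1, Finset.sum_singleton]
        exact mul_ne_zero (Finset.mem_filter.1 hq).2.2 (hw q)

end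

end TannakaKrein

end

/-! ### The maximality theorem -/

theorem theoremA (N : ℕ) (hN : 1 ≤ N) : TannakaKrein.MaximalAtEasinessLevel N 3 := by
  open TannakaKrein in
  classical
  intro k p α _
  set ξ := ∑ i, α i • xi N (p i) with hξ
  have hleast := generated_isLeast (catNC N) ξ
  have hpart : ∀ q : Setoid (Fin k), ∀ i, (p i).comap Sum.inr = q → p i = toPart q := by
    rintro q i rfl
    exact (toPart_comap_inr (p i)).symm
  let S : Finset (Setoid (Fin k)) := Finset.univ.image fun i => (p i).comap Sum.inr
  -- The three partitions may coincide, so coefficients of equal ones are added before asking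
  -- whether a crossing term survives.
  let c : Setoid (Fin k) → ℂ := fun q => ∑ i with (p i).comap Sum.inr = q, α i
  have hsum : ξ = ∑ q ∈ S, c q • xi N (toPart q) := by
    rw [hξ, ← Finset.sum_fiberwise_of_maps_to (g := fun i => (p i).comap Sum.inr) (t := S)
      (fun i hi => Finset.mem_image_of_mem _ hi)]
    refine Finset.sum_congr rfl fun q _ => ?_
    rw [Finset.sum_smul]
    refine Finset.sum_congr rfl fun i hi => ?_
    rw [hpart q i (Finset.mem_filter.1 hi).2]
  have hS : S.card ≤ 3 := Finset.card_image_le.trans (by simp)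
  by_cases hcross : ∃ q ∈ S, Crossing q ∧ c q ≠ 0
  · right
    refine le_antisymm (hleast.2 ⟨isTannakaKreinDual_catP N, catNC_le_catP N, ?_⟩) ?_
    · exact Submodule.sum_mem _ fun i _ => Submodule.smul_mem _ _ (Submodule.subset_span ⟨_, rfl⟩)
    · obtain ⟨hD, hNC, hmem⟩ := hleast.1
      refine catP_le_of_crossVec_mem hD hNC (crossVec_mem hN hD hNC k S c hS ?_ hcross)
      rw [← hsum]
      exact hmem
  · left
    push Not at hcross
    refine le_antisymm (hleast.2 ⟨isTannakaKreinDual_catNC N, le_rfl, ?_⟩) hleast.1.2.1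
    rw [hsum]
    refine Submodule.sum_mem _ fun q hq => ?_
    by_cases hc : Crossing q
    · rw [hcross q hq hc, zero_smul]
      exact Submodule.zero_mem _
    · exact Submodule.smul_mem _ _ (xi_toPart_mem le_rfl hc)
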